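/- **Theorem 3.6.** *Graphs and $\phi$.* Graphs are finite and simple; $\mathbf G$ is the set of isomorphism classes of graphs (the empty graph included). For a graph $G$ put $$\phi(G)=2^{-3|V(G)|}\sum_{E'\subset E(G)}(-2)^{|E'|}\,\chi_3(G|_{E'}),$$ where $G|_{E'}$ is the spanning subgraph of $G$ with edge set $E'$, and $\chi_3$ is the number of proper colorings of the vertices in three colors. Let $H$ be a graph. For $a,b\subset V(H)$, let $H^{-}_{a,b}$ be the graph obtained from $H$ by adding two new non-adjacent vertices, the first joined to exactly the vertices of $a$ in $H$ and the second to exactly those of $b$; let $H^{+}_{a,b}$ be $H^{-}_{a,b}$ with an edge between the two new vertices. For $x,y,z\subset V(H)$ and a set $E$ of pairs from $\{1,2,3\}$, let $H^{E}_{x,y,z}$ be obtained from $H$ by adding three new vertices $1,2,3$, joined in $H$ to exactly the vertices of $x$, $y$, $z$ respectively, and joined among themselves by the edges of $E$. The sets may overlap; $\triangle$ is the symmetric difference. A function $g$ on $\mathbf G$ with values in an abelian group is a *4-invariant* if, for all $H$ and $a,b\subset V(H)$, $$g(H^{+}_{a,b})-g(H^{-}_{a,b})=g(H^{+}_{a\triangle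 b,\,b})-g(H^{-}_{a\triangle b,\,b}).$$ A function $g\colon\mathbf G\to\mathbb C$ satisfies the *graph Chmutov–Varchenko relations* at $p\in\mathbb C$ if 1. $g$ equals $p$ on the graph with one vertex; 2. $g(G_1\sqcup G_2)=g(G_1)g(G_2)$ for all $G_1,G_2$; 3. $g(G)=(p-\tfrac12)\,g(G')$ whenever $G'$ is obtained from $G$ by removing a vertex of degree $1$; 4. for all $H$ and all $x,y,z\subset V(H)$, $$g(H^{\{12,23\}}_{x,y,z})-g(H^{\{12\}}_{x,y,z})-g(H^{\{23\}}_{x,y,z})+g(H^{\varnothing}_{x,y,z})=\tfrac12 g(H^{-}_{y,\,x\triangle y\triangle z})-\tfrac12 g(H^{+}_{x\triangle y,\,y\triangle z}),$$ $$g(H^{\{13,12,23\}}_{x,y,z})-g(H^{\{13,12\}}_{x,y,z})-g(H^{\{13,23\}}_{x,y,z})+g(H^{\{13\}}_{x,y,z})=\tfrac12 g(H^{-}_{y,\,x\triangle y\triangle z})-\tfrac12 g(H^{-}_{x\triangle y,\,y\triangle z}).$$ *Chord diagrams.* A chord diagram of order $n\ge 0$ is a set of $2n$ distinct points on an oriented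 circle with a complete pairing of these points (the pairs are the chords), up to orientation-preserving diffeomorphisms of the circle; $\mathbf A$ is the set of all chord diagrams. It is written as the word of the chord names read along the circle from any cut point, so that every name occurs exactly twice. The intersection graph $\Gamma_D$ of $D\in\mathbf A$ has the chords of $D$ as vertices, and two chords are adjacent if they intersect (their endpoints interlace). The $\mathfrak{sl}(2)$-weight system (for the Killing form) is the function $w_{\mathfrak{sl}(2)}=w\colon\mathbf A\to\mathbb C[c]$ defined by the following axioms: 1. $w=c$ on the diagram with one chord; 2. $w(D)=w(D_1)w(D_2)$ whenever $D$ is glued from $D_1$ and $D_2$ by breaking both circles at any points that are not endpoints of chords and gluing them with respect to the orientation; 3. $w(D)=(c-\tfrac12)\,w(D')$ whenever $D'$ is obtained from $D$ by removing a chord that intersects exactly one other chord; 4. for distinct chords $a,b,d$ and words $P,Q,R,S$ listing the endpoints of all other chords on four arcs, $$w(ba\,PbQdR\,ad\,S)-w(ab\,PbQdR\,ad\,S)-w(ba\,PbQdR\,da\,S)+w(ab\,PbQdR\,da\,S)=\tfrac12 w(bPdQdRbS)-\tfrac12 w(bPdQbRdS),$$ $$w(ba\,PdQbR\,ad\,S)-w(ab\,PdQbR\,ad\,S)-w(ba\,PdQbR\,da\,S)+w(ab\,PdQbR\,da\,S)=\tfrac12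 w(bPdQdRbS)-\tfrac12 w(bPbQdRdS).$$ *Statement.* The function $\phi$ is a 4-invariant and satisfies the graph Chmutov–Varchenko relations at $p=\tfrac38$. There is exactly one function $w_{\mathfrak{sl}(2)}\colon\mathbf A\to\mathbb C[c]$ satisfying the axioms above, and for every chord diagram $D$ $$\phi(\Gamma_D)=w_{\mathfrak{sl}(2)}(D)\big|_{c=3/8},$$ so that $\phi$ extends the specialization of $w_{\mathfrak{sl}(2)}$ at $c=\tfrac38$ from intersection graphs of chord diagrams to all graphs. -/

import Mathlib

open scoped symmDiff

namespace SlTwo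

/-! ### Isomorphism classes of finite simple graphs -/

/-- A finite simple graph, bundled with its vertex type. -/
structure FinGraph : Type 1 where
  V : Type
  fin : Finite V
  graph : SimpleGraph V

/-- Two finite simple graphs are identified when they are isomorphic. -/
instance FinGraph.isoSetoid : Setoid FinGraph where
  r G H := Nonempty (G.graph ≃g H.graph)
  iseqv :=
    ⟨fun _ => ⟨SimpleGraph.Iso.refl⟩, fun ⟨e⟩ => ⟨e.symm⟩, fun ⟨e⟩ ⟨f⟩ => ⟨e.trans f⟩⟩

/-- The set of isomorphism classes of finite simple graphs (the empty graph included). -/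
def GraphClass : Type 1 := Quotient FinGraph.isoSetoid

/-- The isomorphism class of a simple graph on a finite vertex set. -/
def cls {V : Type} [hV : Finite V] (G : SimpleGraph V) : GraphClass :=
  Quotient.mk FinGraph.isoSetoid ⟨V, hV, G⟩

/-! ### The function `phi` -/

/-- The set of edges of a graph on a finite vertex set, as a finset. -/
noncomputable def edges {V : Type} [Finite V] (G : SimpleGraph V) : Finset (Sym2 V) :=
  (Set.toFinite G.edgeSet).toFinset

/-- The number of proper colorings of the vertices in three colors. -/
noncomputable def chi3 {V : Type} (G : SimpleGraph V) : ℕ := Nat.card (G.Coloring (Fin 3))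

/-- `2 ^ (-3 |V|) * ∑_{E' ⊆ E(G)} (-2) ^ |E'| * χ₃(G|_{E'})`, where `G|_{E'}` is the spanning
subgraph with edge set `E'`. -/
noncomputable def phiSum {V : Type} [Finite V] (G : SimpleGraph V) : ℂ :=
  ((2 : ℂ) ^ (3 * Nat.card V))⁻¹ *
    ∑ E' ∈ (edges G).powerset,
      (-2 : ℂ) ^ E'.card * (chi3 (SimpleGraph.fromEdgeSet (E' : Set (Sym2 V))) : ℂ)

theorem chi3_congr {V W : Type} {G : SimpleGraph V} {H : SimpleGraph W} (e : G ≃g H) :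
    chi3 G = chi3 H :=
  Nat.card_congr
    { toFun := fun c => c.comp e.symm.toHom
      invFun := fun c => c.comp e.toHom
      left_inv := fun c => by ext v; simp
      right_inv := fun c => by ext v; simp }

theorem phiSum_congr {V W : Type} [Finite V] [Finite W] {G : SimpleGraph V} {H : SimpleGraph W}
    (e : G ≃g H) : phiSum G = phiSum H := by
  classical
  unfold phiSum
  rw [Nat.card_congr e.toEquiv]
  congr 1
  have hinj : Function.Injective (Sym2.map e) := Sym2.map.injective e.injective
  have hedge : ∀ s : Sym2 V, Sym2.map e s ∈ H.edgeSet ↔ s ∈ G.edgeSet := by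
    intro s
    induction s with
    | _ a b => simpa using e.map_adj_iff
  refine Finset.sum_bij' (fun E' _ => E'.image (Sym2.map e))
    (fun E' _ => E'.image (Sym2.map e.symm)) ?_ ?_ ?_ ?_ ?_
  · intro E' h
    simp only [Finset.mem_powerset, edges] at h ⊢
    intro s hs
    obtain ⟨t, ht, rfl⟩ := Finset.mem_image.1 hs
    have := h ht
    simp only [Set.Finite.mem_toFinset] at this ⊢
    exact (hedge t).2 this
  · intro E' h
    simp only [Finset.mem_powerset, edges] at h ⊢
    intro s hs
    obtain ⟨t, ht, rfl⟩ := Finset.mem_image.1 hs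
    have := h ht
    simp only [Set.Finite.mem_toFinset] at this ⊢
    rw [← hedge, Sym2.map_map]
    simpa [Function.comp_def] using this
  · intro E' _
    rw [Finset.image_image, ← Sym2.map_comp]
    simp [Function.comp_def]
  · intro E' _
    rw [Finset.image_image, ← Sym2.map_comp]
    simp [Function.comp_def]
  · intro E' _
    rw [Finset.card_image_of_injective _ hinj]
    congr 2
    refine chi3_congr ⟨e.toEquiv, ?_⟩
    intro a b
    simp only [SimpleGraph.fromEdgeSet_adj, Finset.coe_image]
    rw [show s(e.toEquiv a, e.toEquiv b) = Sym2.map e s(a, b) from rfl,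
      hinj.mem_set_image]
    simp

/-- The function `phi` on isomorphism classes of graphs. -/
noncomputable def phi : GraphClass → ℂ :=
  Quotient.lift (fun G : FinGraph => haveI := G.fin; phiSum G.graph)
    fun G H ⟨e⟩ => by
      have := G.fin
      have := H.fin
      exact phiSum_congr e

theorem phi_cls {V : Type} [Finite V] (G : SimpleGraph V) : phi (cls G) = phiSum G := rfl

/-! ### Relations for graph invariants -/

/-- The graph on `Fin k ⊕ V` drawn by showing `k` vertices individually: `K` gives the edges
between the shown vertices, `H` is the part of the graph that is not shown, and the shown
vertex `i` is joined to exactly the vertices of the set `N i` of the part not shown. The sets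
`N i` may overlap. -/
def attach {V : Type} {k : ℕ} (K : SimpleGraph (Fin k)) (N : Fin k → Set V) (H : SimpleGraph V) :
    SimpleGraph (Fin k ⊕ V) where
  Adj
    | .inl i, .inl j => K.Adj i j
    | .inl i, .inr v => v ∈ N i
    | .inr v, .inl i => v ∈ N i
    | .inr u, .inr v => H.Adj u v
  symm := ⟨by
    rintro (i | u) (j | v) h
    · exact SimpleGraph.Adj.symm h
    · exact h
    · exact h
    · exact SimpleGraph.Adj.symm h⟩
  loopless := ⟨by
    rintro (i | u) h
    · exact SimpleGraph.irrefl K h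
    · exact SimpleGraph.irrefl H h⟩

/-- The graph with two shown vertices, joined by an edge, with neighbourhoods `a` and `b` in
the part not shown. -/
def joined {V : Type} (H : SimpleGraph V) (a b : Set V) : SimpleGraph (Fin 2 ⊕ V) :=
  attach (SimpleGraph.fromEdgeSet {s(0, 1)}) ![a, b] H

/-- The graph with two shown vertices, not joined by an edge, with neighbourhoods `a` and `b`
in the part not shown. -/
def separate {V : Type} (H : SimpleGraph V) (a b : Set V) : SimpleGraph (Fin 2 ⊕ V) :=
  attach ⊥ ![a, b] H

/-- The graph with three shown vertices `0`, `1`, `2`, with neighbourhoods `x`, `y`, `z` in the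
part not shown, and with the edges of `E` between the shown vertices. -/
def triple {V : Type} (H : SimpleGraph V) (x y z : Set V) (E : Set (Sym2 (Fin 3))) :
    SimpleGraph (Fin 3 ⊕ V) :=
  attach (SimpleGraph.fromEdgeSet E) ![x, y, z] H

/-- The graph four-term relations. -/
def IsFourInvariant {M : Type*} [AddCommGroup M] (g : GraphClass → M) : Prop :=
  ∀ (V : Type) [Finite V] (H : SimpleGraph V) (a b : Set V),
    g (cls (joined H a b)) - g (cls (separate H a b)) =
      g (cls (joined H (a ∆ b) b)) - g (cls (separate H (a ∆ b) b))

/-- The graph Chmutov–Varchenko relations at `p`. -/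
structure SatisfiesGraphCV (g : GraphClass → ℂ) (p : ℂ) : Prop where
  normalization : g (cls (⊥ : SimpleGraph (Fin 1))) = p
  multiplicativity : ∀ (V W : Type) [Finite V] [Finite W] (G : SimpleGraph V) (H : SimpleGraph W),
    g (cls (G ⊕g H)) = g (cls G) * g (cls H)
  /-- `v` is a vertex of degree one, and `G.induce {v}ᶜ` is `G` with `v` removed. -/
  leaf_deletion : ∀ (V : Type) [Finite V] (G : SimpleGraph V) (v : V),
    (∃! u, G.Adj v u) → g (cls G) = (p - 1 / 2) * g (cls (G.induce {v}ᶜ))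
  six_term_first : ∀ (V : Type) [Finite V] (H : SimpleGraph V) (x y z : Set V),
    g (cls (triple H x y z {s(0, 1), s(1, 2)})) - g (cls (triple H x y z {s(0, 1)}))
        - g (cls (triple H x y z {s(1, 2)})) + g (cls (triple H x y z ∅)) =
      1 / 2 * g (cls (separate H y (x ∆ y ∆ z))) - 1 / 2 * g (cls (joined H (x ∆ y) (y ∆ z)))
  six_term_second : ∀ (V : Type) [Finite V] (H : SimpleGraph V) (x y z : Set V),
    g (cls (triple H x y z {s(0, 2), s(0, 1), s(1, 2)}))
        - g (cls (triple H x y z {s(0, 2), s(0, 1)}))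
        - g (cls (triple H x y z {s(0, 2), s(1, 2)})) + g (cls (triple H x y z {s(0, 2)})) =
      1 / 2 * g (cls (separate H y (x ∆ y ∆ z))) - 1 / 2 * g (cls (separate H (x ∆ y) (y ∆ z)))

/-! ### Chord diagrams -/

/-- A chord diagram on an oriented circle that is cut at a point different from the endpoints of
the chords. Going around the circle along its orientation from the cut, one writes down, at
each of the `2n` marked points, the name of the chord that ends there; so every name that
occurs does so exactly twice. -/
structure ChordWord where
  letters : List ℕ
  twice : ∀ a ∈ letters, letters.count a = 2

/-- Words that differ by the choice of the cut (a rotation) and of the names of the chords give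
the same chord diagram. -/
instance ChordWord.rotSetoid : Setoid ChordWord where
  r D D' := ∃ σ : Equiv.Perm ℕ, D.letters.map σ ~r D'.letters
  iseqv := by
    refine ⟨fun D => ⟨Equiv.refl ℕ, by simp [List.IsRotated.refl]⟩, ?_, ?_⟩
    · rintro D D' ⟨σ, h⟩
      refine ⟨σ.symm, ?_⟩
      have := (h.map σ.symm).symm
      simpa [List.map_map] using this
    · rintro D D' D'' ⟨σ, h⟩ ⟨τ, h'⟩
      refine ⟨σ.trans τ, ?_⟩
      have := (h.map τ).trans h'
      simpa [List.map_map] using this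

/-- Chord diagrams, up to orientation-preserving diffeomorphisms of the circle. -/
def ChordDiagram : Type := Quotient ChordWord.rotSetoid

/-- The chord diagram given by a word. -/
def ChordWord.diagram (D : ChordWord) : ChordDiagram := Quotient.mk ChordWord.rotSetoid D

/-- The endpoints of the chords `a` and `b` interlace, that is, the chords intersect. -/
def Interlaced (l : List ℕ) (a b : ℕ) : Prop :=
  a ≠ b ∧ ([a, b, a, b].Sublist l ∨ [b, a, b, a].Sublist l)

/-- The intersection graph of a word: its vertices are the chords, and two of them are adjacent
when the chords intersect. -/
def ChordWord.interGraph (D : ChordWord) : SimpleGraph {a // a ∈ D.letters} where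
  Adj a b := Interlaced D.letters a b
  symm := ⟨fun _ _ h => ⟨h.1.symm, h.2.symm⟩⟩
  loopless := ⟨fun _ h => h.1 rfl⟩

instance ChordWord.finite_chords (D : ChordWord) : Finite {a // a ∈ D.letters} :=
  (List.finite_toSet D.letters).to_subtype

theorem Interlaced.map {l : List ℕ} {a b : ℕ} (σ : Equiv.Perm ℕ) (h : Interlaced l a b) :
    Interlaced (l.map σ) (σ a) (σ b) := by
  refine ⟨fun e => h.1 (σ.injective e), ?_⟩
  rcases h.2 with h | h
  · exact Or.inl (h.map σ)
  · exact Or.inr (h.map σ)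

theorem sublist_rotated {l l' : List ℕ} (h : l ~r l') (a b : ℕ) (hs : [a, b, a, b].Sublist l) :
    [a, b, a, b].Sublist l' ∨ [b, a, b, a].Sublist l' := by
  obtain ⟨n, hn, rfl⟩ := List.isRotated_iff_mod.1 h
  rw [List.rotate_eq_drop_append_take hn]
  rw [← List.take_append_drop n l, List.sublist_append_iff] at hs
  obtain ⟨s, t, hst, hs, ht⟩ := hs
  have key := ht.append hs
  rcases s with _ | ⟨c₁, _ | ⟨c₂, _ | ⟨c₃, _ | ⟨c₄, s⟩⟩⟩⟩ <;>
    simp only [List.nil_append, List.cons_append, List.cons.injEq, List.nil_eq,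
      List.append_eq_nil_iff] at hst <;> aesop

theorem Interlaced.rotated {l l' : List ℕ} (hr : l ~r l') {a b : ℕ} (h : Interlaced l a b) :
    Interlaced l' a b := by
  refine ⟨h.1, ?_⟩
  rcases h.2 with h | h
  · exact sublist_rotated hr a b h
  · exact (sublist_rotated hr b a h).symm

/-- The intersection graph of a chord diagram. -/
def intersectionGraph : ChordDiagram → GraphClass :=
  Quotient.lift (fun D : ChordWord => cls D.interGraph) fun D D' ⟨σ, h⟩ => by
    refine Quotient.sound ⟨⟨σ.subtypeEquiv fun a => ?_, ?_⟩⟩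
    · rw [← h.mem_iff]
      simp
    · rintro ⟨a, ha⟩ ⟨b, hb⟩
      change Interlaced D'.letters (σ a) (σ b) ↔ Interlaced D.letters a b
      constructor
      · intro hi
        have := (hi.rotated h.symm).map σ.symm
        simpa [List.map_map] using this
      · intro hi
        exact (hi.map σ).rotated h

theorem intersectionGraph_diagram (D : ChordWord) :
    intersectionGraph D.diagram = cls D.interGraph := rfl

/-! ### The `sl(2)`-weight system -/

/-- The axioms that define the `sl(2)`-weight system, with values in the polynomials in one
variable `c` over the complex numbers; `c`, the Casimir element for the Killing form, is
`Polynomial.X`.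

In the six-term relations, `P`, `Q`, `R`, `S` list the ends of the other chords on the four arcs
that are not drawn, and are the same in all six diagrams. -/
structure IsSl2WeightSystem (w : ChordDiagram → Polynomial ℂ) : Prop where
  normalization : ∀ (D : ChordWord) (a : ℕ), D.letters = [a, a] → w D.diagram = Polynomial.X
  /-- `D` is glued from `D₁` and `D₂`, broken at the cuts of the two words; all words that
  represent the two factors are allowed here, that is, all choices of the break points. -/
  multiplicativity : ∀ D₁ D₂ D : ChordWord, D.letters = D₁.letters ++ D₂.letters →
    w D.diagram = w D₁.diagram * w D₂.diagram
  /-- The chord `a` intersects exactly one other chord, and `D'` is `D` without `a`. -/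
  leaf_deletion : ∀ (D D' : ChordWord) (a : ℕ), (∃! b, Interlaced D.letters a b) →
    D'.letters = D.letters.filter (fun x => x ≠ a) →
    w D.diagram = (Polynomial.X - Polynomial.C (1 / 2)) * w D'.diagram
  six_term_first : ∀ (a b d : ℕ) (P Q R S : List ℕ) (D₁ D₂ D₃ D₄ D₅ D₆ : ChordWord),
    D₁.letters = [b, a] ++ P ++ [b] ++ Q ++ [d] ++ R ++ [a, d] ++ S →
    D₂.letters = [a, b] ++ P ++ [b] ++ Q ++ [d] ++ R ++ [a, d] ++ S →
    D₃.letters = [b, a] ++ P ++ [b] ++ Q ++ [d] ++ R ++ [d, a] ++ S →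
    D₄.letters = [a, b] ++ P ++ [b] ++ Q ++ [d] ++ R ++ [d, a] ++ S →
    D₅.letters = [b] ++ P ++ [d] ++ Q ++ [d] ++ R ++ [b] ++ S →
    D₆.letters = [b] ++ P ++ [d] ++ Q ++ [b] ++ R ++ [d] ++ S →
    w D₁.diagram - w D₂.diagram - w D₃.diagram + w D₄.diagram =
      Polynomial.C (1 / 2) * w D₅.diagram - Polynomial.C (1 / 2) * w D₆.diagram
  six_term_second : ∀ (a b d : ℕ) (P Q R S : List ℕ) (D₁ D₂ D₃ D₄ D₅ D₆ : ChordWord),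
    D₁.letters = [b, a] ++ P ++ [d] ++ Q ++ [b] ++ R ++ [a, d] ++ S →
    D₂.letters = [a, b] ++ P ++ [d] ++ Q ++ [b] ++ R ++ [a, d] ++ S →
    D₃.letters = [b, a] ++ P ++ [d] ++ Q ++ [b] ++ R ++ [d, a] ++ S →
    D₄.letters = [a, b] ++ P ++ [d] ++ Q ++ [b] ++ R ++ [d, a] ++ S →
    D₅.letters = [b] ++ P ++ [d] ++ Q ++ [d] ++ R ++ [b] ++ S →
    D₆.letters = [b] ++ P ++ [b] ++ Q ++ [d] ++ R ++ [d] ++ S →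
    w D₁.diagram - w D₂.diagram - w D₃.diagram + w D₄.diagram =
      Polynomial.C (1 / 2) * w D₅.diagram - Polynomial.C (1 / 2) * w D₆.diagram

end SlTwo

/-!
Contracting the chords of a diagram `D` with an orthonormal basis of `sl(2)`, in a representation
where the Casimir element acts as the number `c`, gives a matrix: the sum, over all colorings of
the chords by the three basis elements, of the products read along the circle (`stateSum`).
It commutes with `sl(2)`, since the tensor `∑ X k ⊗ X k` is invariant, so in an irreducible
representation it is a scalar. Its normalized trace satisfies the axioms with the indeterminate
specialized to `c` (`IsSpinTriple.isWeightSystemAt`): traces are cyclic, the six-term relations are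
the contraction of two structure tensors (`IsSpinTriple.sum_comm_comm`), and a chord with a single
intersection is removed by `IsSpinTriple.sum_mul_mul`. The irreducible representation of dimension
`N` has `c = (N ^ 2 - 1) / 8`.

Conversely the axioms determine all values. Take a chord `a` and one of its arcs carrying as few
ends as possible. If the arc is empty or carries one end, multiplicativity or leaf deletion removes
`a`; otherwise the six-term relation for `a` and the two extreme chords of the arc shortens the arc
or removes a chord (`isDetermined_of_hasArc`). Hence every diagram has a polynomial whose value at
any `c ≠ 0` is the value of every weight system at `c`. These polynomials satisfy the axioms at the
infinitely many numbers `(N ^ 2 - 1) / 8`, hence identically, which gives existence, and any other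
solution agrees with them at every `c ≠ 0`, which gives uniqueness.

Expanding the product of `1 + (sign - 1)` over the edges, `phi G` becomes `8 ^ (-|V|)` times the sum
over all colorings of `V` by three colors of the product of the signs of the edges: `1` when the
ends have equal colors and `-1` otherwise (`phiSum_eq`). If a set `a` of vertices is colored, let
`s i` be the product of the signs of the edges from a new vertex of color `i` to `a`. Then
`s 0 * s 1 * s 2 = 1`, and symmetric differences of sets give products of signs; all relations for
`phi` become identities between a few signs. In the two-dimensional representation, where
`c = 3 / 8`, the basis consists of anticommuting square roots of `1 / 8`, so the product along `D`
is the scalar `8 ^ (-n)` times the product of the signs of the edges of the intersection graph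
(`wordProd_eq_smul`). Hence `phi` on intersection graphs is this weight system.
-/

namespace SlTwo

/-! ### Sums over colorings -/

section ColorSum

variable {V A B : Type*} [DecidableEq V]

/-- The sum of `F` over all colorings obtained from a given one by recoloring the entries of a
list with three colors. It is meant for lists without repetitions. -/
def colorSum [AddCommMonoid A] : List V → ((V → Fin 3) → A) → (V → Fin 3) → A
  | [], F, f => F f
  | a :: L, F, f => ∑ k, colorSum L F (Function.update f a k)

theorem colorSum_append [AddCommMonoid A] (L M : List V) (F : (V → Fin 3) → A) :
    colorSum (L ++ M) F = colorSum L (colorSum M F) := by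
  induction L with
  | nil => rfl
  | cons a L ih => funext f; simp [colorSum, ih]

theorem colorSum_perm [AddCommMonoid A] {L M : List V} (h : L.Perm M) (F : (V → Fin 3) → A) :
    colorSum L F = colorSum M F := by
  induction h with
  | nil => rfl
  | cons a _ ih => funext f; simp [colorSum, ih]
  | swap a b L =>
    funext f
    by_cases hab : a = b
    · subst hab; rfl
    · simp only [colorSum]
      rw [Finset.sum_comm]
      simp only [Function.update_comm hab]
  | trans _ _ ih₁ ih₂ => rw [ih₁, ih₂]

theorem colorSum_map [AddCommMonoid A] [AddCommMonoid B] (φ : A →+ B) (L : List V)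
    (F : (V → Fin 3) → A) (f : V → Fin 3) :
    colorSum L (fun g => φ (F g)) f = φ (colorSum L F f) := by
  induction L generalizing f with
  | nil => rfl
  | cons a L ih => simp [colorSum, ih]

theorem colorSum_add [AddCommMonoid A] (L : List V) (F G : (V → Fin 3) → A) (f : V → Fin 3) :
    colorSum L (fun g => F g + G g) f = colorSum L F f + colorSum L G f := by
  induction L generalizing f with
  | nil => rfl
  | cons a L ih => simp [colorSum, ih, Finset.sum_add_distrib]

theorem colorSum_sub [AddCommGroup A] (L : List V) (F G : (V → Fin 3) → A) (f : V → Fin 3) :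
    colorSum L (fun g => F g - G g) f = colorSum L F f - colorSum L G f := by
  induction L generalizing f with
  | nil => rfl
  | cons a L ih => simp [colorSum, ih, Finset.sum_sub_distrib]

theorem colorSum_smul {R : Type*} [Monoid R] [AddCommMonoid A] [DistribMulAction R A] (r : R)
    (L : List V) (F : (V → Fin 3) → A) (f : V → Fin 3) :
    colorSum L (fun g => r • F g) f = r • colorSum L F f :=
  colorSum_map (DistribSMul.toAddMonoidHom A r) L F f

theorem colorSum_zero [AddCommMonoid A] (L : List V) (f : V → Fin 3) :
    colorSum L (fun _ => (0 : A)) f = 0 :=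
  colorSum_map (0 : A →+ A) L (fun _ => 0) f

theorem colorSum_sum [AddCommMonoid A] {ι : Type*} (s : Finset ι) (L : List V)
    (F : ι → (V → Fin 3) → A) (f : V → Fin 3) :
    colorSum L (fun g => ∑ i ∈ s, F i g) f = ∑ i ∈ s, colorSum L (F i) f := by
  classical
  induction s using Finset.induction_on with
  | empty => simp [colorSum_zero]
  | insert i s hi ih => simp [Finset.sum_insert hi, colorSum_add, ih]

theorem colorSum_dependsOn [AddCommMonoid A] {L : List V} {F : (V → Fin 3) → A} {s t : Set V}
    (hF : DependsOn F s) (h : ∀ v ∈ s, v ∈ L ∨ v ∈ t) : DependsOn (colorSum L F) t := by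
  induction L generalizing t with
  | nil => exact hF.mono fun v hv => by simpa using h v hv
  | cons a L ih =>
    intro f g hfg
    refine Finset.sum_congr rfl fun k _ => ?_
    refine ih (t := insert a t) (fun v hv => ?_) fun v hv => ?_
    · rcases h v hv with h | h
      · rcases List.mem_cons.1 h with rfl | h
        · exact Or.inr (Set.mem_insert _ _)
        · exact Or.inl h
      · exact Or.inr (Set.mem_insert_of_mem _ h)
    · by_cases hva : v = a
      · subst hva; simp
      · simp [hva, hfg v (Set.mem_of_mem_insert_of_ne hv hva)]

/-- A factor that ignores the recolored entries can be taken out of the sum. -/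
theorem colorSum_mul_of_dependsOn [NonUnitalNonAssocSemiring A] {L : List V}
    {F G : (V → Fin 3) → A} {s : Set V} (hG : DependsOn G s) (hs : ∀ v ∈ s, v ∉ L)
    (f : V → Fin 3) : colorSum L (fun g => F g * G g) f = colorSum L F f * G f := by
  induction L generalizing f with
  | nil => rfl
  | cons a L ih =>
    simp only [colorSum, Finset.sum_mul]
    refine Finset.sum_congr rfl fun k _ => ?_
    rw [ih fun v hv h => hs v hv (List.mem_cons_of_mem _ h)]
    congr 1
    refine hG fun v hv => ?_
    have : v ≠ a := fun h => hs v hv (h ▸ List.mem_cons_self)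
    simp [this]

/-- A sum over colorings of the images of some vertices, of a function of the pulled back
coloring, is the sum over colorings of these vertices. -/
theorem colorSum_relabel [AddCommMonoid A] {W : Type*} [DecidableEq W] {σ : V → W}
    (hσ : Function.Injective σ) (L : List V) (F : (V → Fin 3) → A) (f : W → Fin 3) :
    colorSum (L.map σ) (fun g => F (g ∘ σ)) f = colorSum L F (f ∘ σ) := by
  induction L generalizing f with
  | nil => rfl
  | cons a L ih =>
    simp only [colorSum, List.map_cons]
    refine Finset.sum_congr rfl fun k _ => ?_
    rw [ih, Function.update_comp_eq_of_injective _ hσ]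

/-- If all vertices are listed, the sum runs over all colorings. -/
theorem colorSum_eq_sum [Fintype V] [AddCommMonoid A] {L : List V} (hL : L.Nodup)
    (h : ∀ v, v ∈ L) (F : (V → Fin 3) → A) (f : V → Fin 3) : colorSum L F f = ∑ c, F c := by
  have key : ∀ M : List V, M.Nodup → ∀ f : V → Fin 3,
      colorSum M F f = ∑ c with ∀ v ∉ M, c v = f v, F c := by
    intro M hM
    induction M with
    | nil =>
      intro f
      rw [colorSum, Finset.sum_eq_single f] <;> simp +contextual [funext_iff]
    | cons a M ih =>
      intro f
      obtain ⟨haM, hM⟩ := List.nodup_cons.1 hM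
      rw [← Finset.sum_fiberwise (g := fun c : V → Fin 3 => c a)]
      refine Finset.sum_congr rfl fun k _ => ?_
      rw [ih hM]
      congr 1
      ext c
      simp only [Finset.mem_filter, Finset.mem_univ, true_and, List.mem_cons, not_or]
      refine ⟨fun h => ⟨fun v hv => ?_, ?_⟩, fun h v hv => ?_⟩
      · rw [h v hv.2, Function.update_of_ne hv.1]
      · rw [h a haM, Function.update_self]
      · by_cases hva : v = a
        · subst hva; rw [h.2, Function.update_self]
        · rw [h.1 v ⟨hva, hv⟩, Function.update_of_ne hva]
  rw [key L hL]
  simp [h]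

end ColorSum

/-! ### Products along a word -/

section WordProd

variable {A : Type*} [Ring A] (X : Fin 3 → A)

/-- The product of the elements `X (f x)` over the letters `x` of a word. -/
def wordProd (l : List ℕ) (f : ℕ → Fin 3) : A := (l.map fun x => X (f x)).prod

@[simp] theorem wordProd_nil (f : ℕ → Fin 3) : wordProd X [] f = 1 := rfl

@[simp] theorem wordProd_cons (a : ℕ) (l : List ℕ) (f : ℕ → Fin 3) :
    wordProd X (a :: l) f = X (f a) * wordProd X l f := by simp [wordProd]

@[simp] theorem wordProd_append (l m : List ℕ) (f : ℕ → Fin 3) :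
    wordProd X (l ++ m) f = wordProd X l f * wordProd X m f := by simp [wordProd]

theorem wordProd_dependsOn (l : List ℕ) : DependsOn (wordProd X l) {x | x ∈ l} := by
  intro f g h
  unfold wordProd
  congr 1
  exact List.map_congr_left fun x hx => by rw [h x hx]

theorem wordProd_update {l : List ℕ} {a : ℕ} (h : a ∉ l) (f : ℕ → Fin 3) (k : Fin 3) :
    wordProd X l (Function.update f a k) = wordProd X l f :=
  wordProd_dependsOn X l fun x hx => by
    have : x ≠ a := fun e => h (e ▸ hx)
    simp [this]

/-- The contraction of a chord word: the sum, over the colorings of the chords, of the products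
of the elements `X k` along the word. -/
def stateSum (l : List ℕ) : A := colorSum l.dedup (wordProd X l) 0

/-- The contraction may be computed with the chords listed in any order, starting from any
coloring. -/
theorem stateSum_eq {l L : List ℕ} (hL : L.Nodup) (h : ∀ x, x ∈ L ↔ x ∈ l) (f : ℕ → Fin 3) :
    stateSum X l = colorSum L (wordProd X l) f := by
  have hp : l.dedup.Perm L :=
    (List.perm_ext_iff_of_nodup l.nodup_dedup hL).2 fun x => by simp [h]
  rw [stateSum, colorSum_perm hp]
  exact (colorSum_dependsOn (t := ∅) (wordProd_dependsOn X l)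
    fun v hv => Or.inl ((h v).2 hv)).empty _ _

theorem stateSum_map (l : List ℕ) (σ : Equiv.Perm ℕ) : stateSum X (l.map σ) = stateSum X l := by
  rw [stateSum_eq X (L := l.dedup.map σ) (l.nodup_dedup.map σ.injective) (by simp) 0, stateSum]
  rw [show wordProd X (l.map σ) = fun g => wordProd X l (g ∘ σ) from by
    funext g; simp [wordProd, Function.comp_def], colorSum_relabel σ.injective]
  rfl

/-- A tracial functional of the contraction does not depend on the cut of the word. -/
theorem map_stateSum_isRotated (t : A →+ ℂ) (ht : ∀ a b, t (a * b) = t (b * a)) {l m : List ℕ}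
    (h : l ~r m) : t (stateSum X l) = t (stateSum X m) := by
  rw [stateSum_eq X m.nodup_dedup (l := l) (by simp [h.mem_iff]) 0, stateSum,
    ← colorSum_map, ← colorSum_map]
  congr 1
  funext g
  obtain ⟨n, hn, rfl⟩ := List.isRotated_iff_mod.1 h
  rw [List.rotate_eq_drop_append_take hn, wordProd_append, ht, ← wordProd_append,
    List.take_append_drop]

/-- Words without a common chord: the contraction of the glued word is the product. -/
theorem stateSum_append {l m : List ℕ} (h : ∀ x ∈ l, x ∉ m) :
    stateSum X (l ++ m) = stateSum X l * stateSum X m := by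
  have hn : (m.dedup ++ l.dedup).Nodup :=
    List.nodup_append.2 ⟨m.nodup_dedup, l.nodup_dedup, fun x hx y hy e => by
      subst e; exact h _ (List.mem_dedup.1 hy) (List.mem_dedup.1 hx)⟩
  rw [stateSum_eq X hn (by simp [or_comm]) 0, colorSum_append]
  have h₁ : colorSum l.dedup (wordProd X (l ++ m)) = fun f => stateSum X l * wordProd X m f := by
    funext f
    rw [stateSum_eq X l.nodup_dedup (by simp) f, ← colorSum_mul_of_dependsOn
      (wordProd_dependsOn X m) (fun v hv hv' => h v (List.mem_dedup.1 hv') hv)]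
    congr 1
    funext g
    simp
  rw [h₁]
  exact colorSum_map (AddMonoidHom.mulLeft (stateSum X l)) _ _ _

end WordProd

theorem exists_eq_of_count_eq_one {x : ℕ} {U : List ℕ} (h : U.count x = 1) :
    ∃ U₁ U₂, U = U₁ ++ x :: U₂ ∧ x ∉ U₁ ∧ x ∉ U₂ := by
  obtain ⟨U₁, U₂, rfl, h₁⟩ := List.eq_append_cons_of_mem
    (List.count_pos_iff.1 (by omega : 0 < U.count x))
  refine ⟨U₁, U₂, rfl, h₁, fun h₂ => ?_⟩
  have := List.count_pos_iff.2 h₂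
  simp at h
  omega

theorem exists_eq_of_count_eq_two {x : ℕ} {U : List ℕ} (h : U.count x = 2) :
    ∃ U₁ U₂ U₃, U = U₁ ++ x :: (U₂ ++ x :: U₃) ∧ x ∉ U₁ ∧ x ∉ U₂ ∧ x ∉ U₃ := by
  obtain ⟨U₁, W, rfl, h₁⟩ := List.eq_append_cons_of_mem
    (List.count_pos_iff.1 (by omega : 0 < U.count x))
  have hW : W.count x = 1 := by
    rw [List.count_append, List.count_eq_zero_of_not_mem h₁, List.count_cons_self] at h
    omega
  obtain ⟨U₂, U₃, rfl, h₂, h₃⟩ := exists_eq_of_count_eq_one hW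
  exact ⟨U₁, U₂, U₃, rfl, h₁, h₂, h₃⟩

/-! ### Spin triples -/

/-- The image of an orthonormal basis of `sl(2)` (for the Killing form) under a homomorphism to
an associative algebra in which the Casimir element acts as the number `c`. The basis is rescaled
so that the structure constants are `μ` times the sign of the permutation; for the Killing form
this forces `μ ^ 2 = -1/2`. -/
structure IsSpinTriple {A : Type*} [Ring A] [Algebra ℂ A] (X : Fin 3 → A) (μ c : ℂ) : Prop where
  sq : μ * μ = -(1 / 2)
  comm : ∀ k, X k * X (k + 1) - X (k + 1) * X k = μ • X (k + 2)
  casimir : ∑ k, X k * X k = c • (1 : A)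

section SpinTriple

variable {A : Type*} [Ring A] (X : Fin 3 → A)

/-- The part of the commutator of `X i` with the product along a word that comes from the
occurrences of the letter `x`. -/
def letterDeriv (i : Fin 3) (x : ℕ) : List ℕ → (ℕ → Fin 3) → A
  | [], _ => 0
  | y :: U, f => (if y = x then (X i * X (f y) - X (f y) * X i) * wordProd X U f else 0) +
      X (f y) * letterDeriv i x U f

/-- Leibniz rule for the commutator with `X i`, sorted by letters. -/
theorem commutator_wordProd (i : Fin 3) {s : Finset ℕ} {U : List ℕ} (h : ∀ x ∈ U, x ∈ s)
    (f : ℕ → Fin 3) :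
    X i * wordProd X U f - wordProd X U f * X i = ∑ x ∈ s, letterDeriv X i x U f := by
  induction U with
  | nil => simp [letterDeriv]
  | cons y U ih =>
    have ih := ih fun x hx => h x (List.mem_cons_of_mem _ hx)
    simp only [letterDeriv, Finset.sum_add_distrib, ← Finset.mul_sum, ← ih, Finset.sum_ite_eq,
      h y List.mem_cons_self, if_true, wordProd_cons]
    noncomm_ring

variable {X}

theorem letterDeriv_of_notMem (i : Fin 3) {x : ℕ} {U : List ℕ} (h : x ∉ U) (f : ℕ → Fin 3) :
    letterDeriv X i x U f = 0 := by
  induction U with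
  | nil => rfl
  | cons y U ih =>
    simp only [List.mem_cons, not_or] at h
    simp [letterDeriv, ih h.2, Ne.symm h.1]

theorem letterDeriv_append (i : Fin 3) (x : ℕ) (U W : List ℕ) (f : ℕ → Fin 3) :
    letterDeriv X i x (U ++ W) f =
      letterDeriv X i x U f * wordProd X W f + wordProd X U f * letterDeriv X i x W f := by
  induction U with
  | nil => simp [letterDeriv]
  | cons y U ih =>
    simp only [List.cons_append, letterDeriv, ih, wordProd_append, wordProd_cons]
    split_ifs <;> noncomm_ring

variable [Algebra ℂ A] {μ c : ℂ}

theorem IsSpinTriple.comm' (h : IsSpinTriple X μ c) (k : Fin 3) :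
    X (k + 1) * X k - X k * X (k + 1) = (-μ) • X (k + 2) := by
  rw [← neg_sub, h.comm, neg_smul]

/-- The tensor `∑ k, X k ⊗ X k` is invariant. -/
theorem IsSpinTriple.sum_comm_mul (h : IsSpinTriple X μ c) (i : Fin 3) (M : A) :
    ∑ k, ((X i * X k - X k * X i) * M * X k + X k * M * (X i * X k - X k * X i)) = 0 := by
  have h0 := h.comm 0
  have h1 := h.comm 1
  have h2 := h.comm 2
  have h0' := h.comm' 0
  have h1' := h.comm' 1
  have h2' := h.comm' 2
  simp only [Fin.isValue, Fin.reduceAdd, zero_add] at h0 h1 h2 h0' h1' h2'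
  fin_cases i <;>
  simp only [Fin.sum_univ_three, Fin.isValue, Fin.zero_eta, Fin.mk_one, Fin.reduceFinMk,
    h0, h1, h2, h0', h1', h2', sub_self, zero_mul, mul_zero, smul_mul_assoc, mul_smul_comm] <;>
  module

/-- The two ends of a chord that is summed over contribute opposite terms to a commutator. -/
theorem IsSpinTriple.colorSum_letterDeriv (h : IsSpinTriple X μ c) (i : Fin 3) {x : ℕ}
    {U : List ℕ} (hx : U.count x = 2) (f : ℕ → Fin 3) :
    colorSum [x] (letterDeriv X i x U) f = 0 := by
  obtain ⟨U₁, U₂, U₃, rfl, h₁, h₂, h₃⟩ := exists_eq_of_count_eq_two hx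
  have key := congrArg (fun Z => wordProd X U₁ f * Z * wordProd X U₃ f)
    (h.sum_comm_mul i (wordProd X U₂ f))
  simp only [Finset.mul_sum, Finset.sum_mul, mul_zero, zero_mul] at key
  rw [← key]
  refine Finset.sum_congr rfl fun k _ => ?_
  simp only [colorSum, letterDeriv_append, letterDeriv, letterDeriv_of_notMem, h₁, h₂, h₃,
    wordProd_append, wordProd_cons, wordProd_update, not_false_eq_true, Function.update_self,
    if_true]
  noncomm_ring

/-- If every letter of `U` other than `b` is summed over and occurs twice, then only the
occurrences of `b` contribute to a commutator. -/
theorem IsSpinTriple.commutator_colorSum (h : IsSpinTriple X μ c) (i : Fin 3) {b : ℕ}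
    {U L : List ℕ} (hb : b ∉ L) (hU : ∀ x ∈ U, x = b ∨ x ∈ L)
    (hL : ∀ x ∈ L, U.count x = 2) (f : ℕ → Fin 3) :
    X i * colorSum L (wordProd X U) f - colorSum L (wordProd X U) f * X i =
      colorSum L (letterDeriv X i b U) f := by
  have e₁ := colorSum_map (AddMonoidHom.mulLeft (X i)) L (wordProd X U) f
  have e₂ := colorSum_map (AddMonoidHom.mulRight (X i)) L (wordProd X U) f
  simp only [AddMonoidHom.coe_mulLeft, AddMonoidHom.coe_mulRight] at e₁ e₂
  rw [← e₁, ← e₂, ← colorSum_sub]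
  simp only [commutator_wordProd X i (s := insert b L.toFinset) (U := U)
    (fun x hx => by simpa using hU x hx)]
  rw [colorSum_sum, Finset.sum_insert (by simpa using hb), add_eq_left]
  refine Finset.sum_eq_zero fun x hx => ?_
  have hx := List.mem_toFinset.1 hx
  rw [colorSum_perm ((List.perm_cons_erase hx).trans (List.perm_append_singleton x _).symm),
    colorSum_append,
    show colorSum [x] (letterDeriv X i x U) = fun _ => 0 from
      funext fun f => h.colorSum_letterDeriv i (hL x hx) f, colorSum_zero]

/-- The contraction of a chord word is central. -/
theorem IsSpinTriple.commute_stateSum (h : IsSpinTriple X μ c) (i : Fin 3) {U : List ℕ}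
    (hU : ∀ x ∈ U, U.count x = 2) : X i * stateSum X U = stateSum X U * X i := by
  obtain ⟨b, hb⟩ := Infinite.exists_notMem_finset U.toFinset
  have hb : b ∉ U := by simpa using hb
  have := h.commutator_colorSum i (b := b) (L := U.dedup) (by simpa using hb)
    (fun x hx => Or.inr (List.mem_dedup.2 hx)) (fun x hx => hU x (List.mem_dedup.1 hx)) 0
  rw [show letterDeriv X i b U = fun _ => 0 from
    funext fun f => letterDeriv_of_notMem i hb f, colorSum_zero] at this
  exact sub_eq_zero.1 this

/-- If `T` transforms under commutators with the `X i` as the `X i` themselves do, the sum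
`∑ a, X a * T k * X a` is a multiple of `T k`. -/
theorem IsSpinTriple.sum_mul_mul (h : IsSpinTriple X μ c) {T : Fin 3 → A}
    (h₀ : ∀ i, X i * T i - T i * X i = 0)
    (h₁ : ∀ i, X i * T (i + 1) - T (i + 1) * X i = μ • T (i + 2))
    (h₂ : ∀ i, X (i + 1) * T i - T i * X (i + 1) = (-μ) • T (i + 2)) (k : Fin 3) :
    ∑ a, X a * T k * X a = (c - 1 / 2) • T k := by
  have hsum : ∀ F : Fin 3 → A, ∑ a, F a = F k + F (k + 1) + F (k + 2) := by
    intro F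
    fin_cases k <;> simp [Fin.sum_univ_three] <;> abel
  have hk3 : k + 2 + 1 = k := by fin_cases k <;> rfl
  have hk4 : k + 2 + 2 = k + 1 := by fin_cases k <;> rfl
  have hk2 : k + 1 + 1 = k + 2 := by fin_cases k <;> rfl
  have hk5 : k + 1 + 2 = k := by fin_cases k <;> rfl
  have c₁ : (∑ a, X a * X a) * T k = c • T k := by rw [h.casimir]; simp
  have c₂ : T k * (∑ a, X a * X a) = c • T k := by rw [h.casimir]; simp
  rw [hsum] at c₁ c₂ ⊢
  have e0 := h₀ k
  have e1 := h₂ k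
  have e2 := h₁ (k + 2)
  have e3 := h₁ (k + 1)
  have e4 := h₂ (k + 1)
  rw [hk3, hk4] at e2
  rw [hk2, hk5] at e3 e4
  -- Moving one factor `X a` to the left, or else to the right, gives two expressions for the sum.
  have x₁ : X k * T k * X k + X (k + 1) * T k * X (k + 1) + X (k + 2) * T k * X (k + 2) =
      c • T k + μ • (X (k + 1) * T (k + 2)) - μ • (X (k + 2) * T (k + 1)) := by
    rw [← c₁, ← mul_smul_comm, ← mul_smul_comm, ← e2, ← neg_neg (μ • T (k + 2)), ← neg_smul,
      ← e1]
    have e0' := congrArg (X k * ·) e0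
    simp only [mul_zero, mul_sub] at e0'
    rw [sub_eq_zero] at e0'
    simp only [add_mul, mul_sub, mul_neg, mul_assoc] at e0' ⊢
    rw [e0']
    abel
  have x₂ : X k * T k * X k + X (k + 1) * T k * X (k + 1) + X (k + 2) * T k * X (k + 2) =
      c • T k - μ • (T (k + 2) * X (k + 1)) + μ • (T (k + 1) * X (k + 2)) := by
    rw [← c₂, ← smul_mul_assoc, ← smul_mul_assoc, ← e2, ← neg_neg (μ • T (k + 2)), ← neg_smul,
      ← e1]
    have e0' := congrArg (· * X k) e0
    simp only [zero_mul, sub_mul] at e0'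
    rw [sub_eq_zero] at e0'
    simp only [mul_add, sub_mul, neg_mul, mul_assoc] at e0' ⊢
    rw [e0']
    abel
  have x₃ : (X k * T k * X k + X (k + 1) * T k * X (k + 1) + X (k + 2) * T k * X (k + 2)) +
      (X k * T k * X k + X (k + 1) * T k * X (k + 1) + X (k + 2) * T k * X (k + 2)) =
      (2 * (c - 1 / 2)) • T k := by
    nth_rewrite 1 [x₁]
    rw [x₂]
    have : c • T k + μ • (X (k + 1) * T (k + 2)) - μ • (X (k + 2) * T (k + 1)) +
        (c • T k - μ • (T (k + 2) * X (k + 1)) + μ • (T (k + 1) * X (k + 2))) =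
        (2 * c) • T k + μ • (X (k + 1) * T (k + 2) - T (k + 2) * X (k + 1)) -
          μ • (X (k + 2) * T (k + 1) - T (k + 1) * X (k + 2)) := by
      rw [two_mul, add_smul, smul_sub, smul_sub]; abel
    rw [this, e3, e4, smul_smul, smul_smul, ← add_smul, ← sub_smul]
    congr 1
    linear_combination 2 * h.sq
  rw [← two_smul ℂ, mul_smul] at x₃
  exact smul_right_injective A (two_ne_zero (α := ℂ)) x₃

/-- Removal of a chord `a` that intersects only the chord `b`. The arc `U` between the ends of `a`
carries one end of `b` and closed chords, so its contraction transforms like `X` at that end, and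
`IsSpinTriple.sum_mul_mul` applies. -/
theorem IsSpinTriple.stateSum_leaf (h : IsSpinTriple X μ c) {a b : ℕ} {U V : List ℕ}
    (haU : a ∉ U) (haV : a ∉ V) (hb : U.count b = 1) (hbV : b ∈ V)
    (hU : ∀ x ∈ U, x = b ∨ (U.count x = 2 ∧ x ∉ V)) :
    stateSum X (a :: (U ++ a :: V)) = (c - 1 / 2) • stateSum X (U ++ V) := by
  have hbU : b ∈ U := List.count_pos_iff.1 (by omega)
  have hab : a ≠ b := fun e => haU (e ▸ hbU)
  set L := U.dedup.erase b with hLdef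
  have hLn : L.Nodup := U.nodup_dedup.erase b
  have hL : ∀ x, x ∈ L ↔ x ≠ b ∧ x ∈ U := by
    intro x; rw [hLdef, U.nodup_dedup.mem_erase_iff, List.mem_dedup]
  have haL : a ∉ L := fun h => haU ((hL a).1 h).2
  have hLV : ∀ x ∈ L, x ∉ V := fun x hx =>
    (((hU x ((hL x).1 hx).2).resolve_left ((hL x).1 hx).1)).2
  have hbL : b ∉ L := fun h => ((hL b).1 h).1 rfl
  -- the arc `U`, with `b` left open, transforms under commutators like `X` at the end of `b`
  have hT : ∀ (f : ℕ → Fin 3) (i k : Fin 3),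
      X i * colorSum L (wordProd X U) (Function.update f b k) -
        colorSum L (wordProd X U) (Function.update f b k) * X i =
      colorSum L (letterDeriv X i b U) (Function.update f b k) := fun f i k =>
    h.commutator_colorSum i hbL
      (fun x hx => or_iff_not_imp_left.2 fun hxb => (hL x).2 ⟨hxb, hx⟩)
      (fun x hx => (((hU x ((hL x).1 hx).2).resolve_left ((hL x).1 hx).1)).1) _
  obtain ⟨U₁, U₂, hUe, hb₁, hb₂⟩ := exists_eq_of_count_eq_one hb
  have hD : ∀ (f : ℕ → Fin 3) (i k m : Fin 3) (r : ℂ),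
      X i * X k - X k * X i = r • X m →
      colorSum L (letterDeriv X i b U) (Function.update f b k) =
        r • colorSum L (wordProd X U) (Function.update f b m) := by
    intro f i k m r hr
    have rel : ∀ (F : (ℕ → Fin 3) → A) (k : Fin 3), colorSum L F (Function.update f b k) =
        colorSum L (fun g => F (Function.update g b k)) f := by
      intro F k
      clear_value L
      clear hLn hL haL hLV hT hLdef
      induction L generalizing f with
      | nil => rfl
      | cons y L ih =>
        simp only [List.mem_cons, not_or] at hbL
        simp only [colorSum]
        refine Finset.sum_congr rfl fun j _ => ?_
        rw [Function.update_comm hbL.1, ih hbL.2]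
    rw [rel, rel, ← colorSum_smul]
    congr 1
    funext g
    subst hUe
    simp only [letterDeriv_append, letterDeriv, letterDeriv_of_notMem, hb₁, hb₂,
      wordProd_append, wordProd_cons, wordProd_update, not_false_eq_true, Function.update_self,
      if_true, hr]
    simp
  have hvec : ∀ (f : ℕ → Fin 3) (k : Fin 3),
      ∑ i, X i * colorSum L (wordProd X U) (Function.update f b k) * X i =
        (c - 1 / 2) • colorSum L (wordProd X U) (Function.update f b k) := by
    intro f k
    refine h.sum_mul_mul (T := fun k => colorSum L (wordProd X U) (Function.update f b k))
      (fun i => ?_) (fun i => ?_) (fun i => ?_) k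
    · rw [hT, hD f i i i 0 (by simp), zero_smul]
    · rw [hT, hD f i (i + 1) (i + 2) μ (h.comm i)]
    · rw [hT, hD f (i + 1) i (i + 2) (-μ) (h.comm' i)]
  have hvec' : ∀ f : ℕ → Fin 3, ∑ i, X i * colorSum L (wordProd X U) f * X i =
      (c - 1 / 2) • colorSum L (wordProd X U) f := fun f => by
    simpa using hvec f (f b)
  have hn : (V.dedup ++ L).Nodup := List.nodup_append.2
    ⟨V.nodup_dedup, hLn, fun x hx y hy e => by
      subst e; exact hLV _ hy (List.mem_dedup.1 hx)⟩
  have hmem : ∀ x, x ∈ V.dedup ++ L ↔ x ∈ U ++ V := by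
    intro x
    simp only [List.mem_append, List.mem_dedup, hL]
    by_cases hx : x = b
    · subst hx; simp [hbV]
    · simp [hx, or_comm]
  have hmul : ∀ f, colorSum L (fun g => wordProd X U g * wordProd X V g) f =
      colorSum L (wordProd X U) f * wordProd X V f :=
    colorSum_mul_of_dependsOn (wordProd_dependsOn X V) (fun v hv hv' => hLV v hv' hv)
  have hupd : ∀ (f : ℕ → Fin 3) (i : Fin 3),
      colorSum L (wordProd X U) (Function.update f a i) = colorSum L (wordProd X U) f := by
    intro f i
    refine colorSum_dependsOn (t := {x | x ∈ U}) (wordProd_dependsOn X U)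
      (fun v hv => Or.inr hv) fun x hx => ?_
    have : x ≠ a := fun e => haU (e ▸ hx)
    simp [this]
  rw [stateSum_eq X hn hmem 0, stateSum_eq X (L := V.dedup ++ a :: L) ?_ ?_ 0,
    colorSum_append, colorSum_append, ← colorSum_smul]
  · congr 1
    funext f
    have e₁ : colorSum L (wordProd X (U ++ V)) f = colorSum L (wordProd X U) f * wordProd X V f := by
      rw [← hmul]; congr 1; funext g; simp
    rw [e₁, ← smul_mul_assoc, ← hvec', Finset.sum_mul]
    refine Finset.sum_congr rfl fun i _ => ?_
    have e₂ : DependsOn (fun g : ℕ → Fin 3 => X (g a) * wordProd X V g) {x | x = a ∨ x ∈ V} := by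
      intro g g' hg
      simp only
      rw [hg a (Or.inl rfl), wordProd_dependsOn X V fun x hx => hg x (Or.inr hx)]
    have e₃ := colorSum_mul_of_dependsOn (L := L) (F := fun g => X (g a) * wordProd X U g) e₂
      (fun v hv hv' => by
        rcases hv with rfl | hv
        · exact haL hv'
        · exact hLV v hv' hv) (Function.update f a i)
    have e₄ : colorSum L (fun g => X (g a) * wordProd X U g) (Function.update f a i) =
        X i * colorSum L (wordProd X U) (Function.update f a i) := by
      have hd : ∀ (M : List ℕ), a ∉ M → ∀ f : ℕ → Fin 3,
          colorSum M (fun g => X (g a) * wordProd X U g) f = X (f a) * colorSum M (wordProd X U) f := by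
        intro M hM
        induction M with
        | nil => intro f; rfl
        | cons y M ih =>
          intro f
          simp only [List.mem_cons, not_or] at hM
          simp only [colorSum, ih hM.2, Finset.mul_sum]
          simp [Function.update_of_ne hM.1]
      simpa using hd L haL (Function.update f a i)
    rw [show wordProd X (a :: (U ++ a :: V)) =
      fun g => X (g a) * wordProd X U g * (X (g a) * wordProd X V g) from by
        funext g; simp [mul_assoc], e₃, e₄, hupd, wordProd_update X haV]
    simp [mul_assoc]
  · rw [List.nodup_middle, List.nodup_cons]
    refine ⟨?_, hn⟩
    rw [List.mem_append, List.mem_dedup]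
    exact not_or.2 ⟨haV, haL⟩
  · intro x
    have := hmem x
    simp only [List.mem_append, List.mem_cons] at this ⊢
    by_cases hx : x = a
    · simp [hx]
    · simp [hx, ← this]

/-- The algebraic form of the six-term relations: the structure constants contract by
`∑ a, ε b a p * ε a d q = δ b q * δ p d - δ b d * δ p q`, and `μ ^ 2 = -1/2`. -/
theorem IsSpinTriple.sum_comm_comm (h : IsSpinTriple X μ c) (G : Fin 3 → Fin 3 → A) :
    ∑ b, ∑ d, ∑ a, (X b * X a - X a * X b) * G b d * (X a * X d - X d * X a) =
      (1 / 2 : ℂ) • ∑ b, ∑ d, (X b * G d d * X b - X b * G d b * X d) := by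
  have h0 := h.comm 0
  have h1 := h.comm 1
  have h2 := h.comm 2
  have h0' := h.comm' 0
  have h1' := h.comm' 1
  have h2' := h.comm' 2
  simp only [Fin.isValue, Fin.reduceAdd, zero_add] at h0 h1 h2 h0' h1' h2'
  simp only [Fin.sum_univ_three, Fin.isValue, 
    h0, h1, h2, h0', h1', h2', sub_self, zero_mul, mul_zero, smul_mul_assoc, mul_smul_comm,
    smul_smul, neg_mul, mul_neg, neg_neg, h.sq]
  module

end SpinTriple

/-! ### Combinatorics of chord words -/

theorem diagram_eq_of_isRotated {D D' : ChordWord} (h : D.letters ~r D'.letters) :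
    D.diagram = D'.diagram :=
  Quotient.sound ⟨Equiv.refl ℕ, by simpa using h⟩

theorem exists_isRotated_cons {a : ℕ} {l : List ℕ} (h : a ∈ l) : ∃ m, l ~r a :: m := by
  obtain ⟨s, t, rfl⟩ := List.append_of_mem h
  exact ⟨t ++ s, by simpa using (List.isRotated_append (l := s) (l' := a :: t))⟩

theorem isRotated_filter {l m : List ℕ} (h : l ~r m) (p : ℕ → Bool) :
    l.filter p ~r m.filter p := by
  obtain ⟨n, hn, rfl⟩ := List.isRotated_iff_mod.1 h
  rw [List.rotate_eq_drop_append_take hn, List.filter_append]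
  nth_rewrite 1 [← List.take_append_drop n l]
  rw [List.filter_append]
  exact List.isRotated_append

theorem filter_ne_eq_self {a : ℕ} {l : List ℕ} (h : a ∉ l) :
    l.filter (fun x => decide (x ≠ a)) = l :=
  List.filter_eq_self.2 fun x hx => by simpa using fun e : x = a => h (e ▸ hx)

/-- Removal of a chord from a word that begins with it. -/
theorem filter_ne_cons_append_cons {a : ℕ} {U V : List ℕ} (haU : a ∉ U) (haV : a ∉ V) :
    (a :: (U ++ a :: V)).filter (fun x => decide (x ≠ a)) = U ++ V := by
  rw [List.filter_cons_of_neg (by simp), List.filter_append, List.filter_cons_of_neg (by simp),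
    filter_ne_eq_self haU, filter_ne_eq_self haV]

/-- Every chord can be put at the beginning of the word. -/
theorem exists_isRotated_chord {a : ℕ} {l : List ℕ} (h : l.count a = 2) :
    ∃ U V, l ~r a :: (U ++ a :: V) ∧ a ∉ U ∧ a ∉ V := by
  obtain ⟨m, hm⟩ := exists_isRotated_cons (List.count_pos_iff.1 (by omega : 0 < l.count a))
  have h2 := hm.perm.count_eq a
  rw [List.count_cons_self, h] at h2
  obtain ⟨U, V, rfl, hU, hV⟩ := exists_eq_of_count_eq_one (by omega : m.count a = 1)
  exact ⟨U, V, hm, hU, hV⟩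

/-- A chord meets `a` when it has one end on each of the two arcs cut out by `a`. -/
theorem interlaced_cons_iff {a y : ℕ} {U V : List ℕ} (haU : a ∉ U) (haV : a ∉ V)
    (hya : y ≠ a) : Interlaced (a :: (U ++ a :: V)) a y ↔ y ∈ U ∧ y ∈ V := by
  constructor
  · rintro ⟨-, h | h⟩
    · have h := List.cons_sublist_cons.1 h
      obtain ⟨s, t, hst, hs, ht⟩ := List.sublist_append_iff.1 h
      rcases s with _ | ⟨c₁, _ | ⟨c₂, s⟩⟩
      · obtain rfl : [y, a, y] = t := by simpa using hst
        have := (List.sublist_cons_iff.1 ht).resolve_right (by simp [hya])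
        exact absurd (this.subset (by simp)) haV
      · simp only [List.cons_append, List.nil_append, List.cons.injEq] at hst
        obtain ⟨rfl, rfl⟩ := hst
        exact ⟨hs.subset (by simp), (List.cons_sublist_cons.1 ht).subset (by simp)⟩
      · simp only [List.cons_append, List.cons.injEq] at hst
        obtain ⟨rfl, rfl, -⟩ := hst
        exact absurd (hs.subset (by simp)) haU
    · have h := (List.sublist_cons_iff.1 h).resolve_right (by simp [hya])
      have := h.count_le a
      simp [List.count_eq_zero_of_not_mem haU, List.count_eq_zero_of_not_mem haV, hya] at this
  · rintro ⟨h₁, h₂⟩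
    refine ⟨hya.symm, Or.inl (List.cons_sublist_cons.2 ?_)⟩
    exact (List.singleton_sublist.2 h₁).append
      (List.cons_sublist_cons.2 (List.singleton_sublist.2 h₂))

theorem ChordWord.count_eq {D : ChordWord} {l : List ℕ} (h : D.letters ~r l) {x : ℕ}
    (hx : x ∈ l) : l.count x = 2 := by
  rw [← h.perm.count_eq]
  exact D.twice x (h.mem_iff.2 hx)

/-- The names of the three shown chords in a six-term relation are distinct and do not occur on
the remaining arcs. -/
theorem six_term_names {a b d : ℕ} {P Q R S l : List ℕ} (h : ∀ x ∈ l, l.count x = 2)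
    (hl : l.Perm (a :: a :: b :: b :: d :: d :: (P ++ Q ++ R ++ S))) :
    a ≠ b ∧ a ≠ d ∧ b ≠ d ∧ ∀ x ∈ [a, b, d], x ∉ P ∧ x ∉ Q ∧ x ∉ R ∧ x ∉ S := by
  have key : ∀ x ∈ [a, b, d],
      (a :: a :: b :: b :: d :: d :: (P ++ Q ++ R ++ S)).count x = 2 := by
    intro x hx
    rw [← hl.count_eq]
    refine h x (hl.mem_iff.2 ?_)
    simp only [List.mem_cons, List.not_mem_nil, or_false] at hx ⊢
    tauto
  have ha := key a (by simp)
  have hb := key b (by simp)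
  have hd := key d (by simp)
  simp only [List.count_cons, List.count_append, beq_iff_eq] at ha hb hd
  have hab : a ≠ b := by rintro rfl; simp at ha
  have had : a ≠ d := by rintro rfl; simp at ha
  have hbd : b ≠ d := by rintro rfl; simp at hb; omega
  refine ⟨hab, had, hbd, fun x hx => ?_⟩
  have hx' : x = a ∨ x = b ∨ x = d := by simpa using hx
  have h2 := key x hx
  simp only [List.count_cons, List.count_append, beq_iff_eq] at h2
  have h0 : P.count x = 0 ∧ Q.count x = 0 ∧ R.count x = 0 ∧ S.count x = 0 := by
    rcases hx' with rfl | rfl | rfl <;> simp [hab, hab.symm, had, had.symm, hbd, hbd.symm] at h2 <;>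
      refine ⟨?_, ?_, ?_, ?_⟩ <;> simp [h2]
  simpa only [List.count_eq_zero] using h0

/-! ### Numerical weight systems -/

/-- The axioms of the `sl(2)`-weight system with the indeterminate specialized to a number. -/
structure IsWeightSystemAt (c : ℂ) (w : ChordDiagram → ℂ) : Prop where
  normalization : ∀ (D : ChordWord) (a : ℕ), D.letters = [a, a] → w D.diagram = c
  multiplicativity : ∀ D₁ D₂ D : ChordWord, D.letters = D₁.letters ++ D₂.letters →
    w D.diagram = w D₁.diagram * w D₂.diagram
  leaf_deletion : ∀ (D D' : ChordWord) (a : ℕ), (∃! b, Interlaced D.letters a b) →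
    D'.letters = D.letters.filter (fun x => x ≠ a) →
    w D.diagram = (c - 1 / 2) * w D'.diagram
  six_term_first : ∀ (a b d : ℕ) (P Q R S : List ℕ) (D₁ D₂ D₃ D₄ D₅ D₆ : ChordWord),
    D₁.letters = [b, a] ++ P ++ [b] ++ Q ++ [d] ++ R ++ [a, d] ++ S →
    D₂.letters = [a, b] ++ P ++ [b] ++ Q ++ [d] ++ R ++ [a, d] ++ S →
    D₃.letters = [b, a] ++ P ++ [b] ++ Q ++ [d] ++ R ++ [d, a] ++ S →
    D₄.letters = [a, b] ++ P ++ [b] ++ Q ++ [d] ++ R ++ [d, a] ++ S →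
    D₅.letters = [b] ++ P ++ [d] ++ Q ++ [d] ++ R ++ [b] ++ S →
    D₆.letters = [b] ++ P ++ [d] ++ Q ++ [b] ++ R ++ [d] ++ S →
    w D₁.diagram - w D₂.diagram - w D₃.diagram + w D₄.diagram =
      1 / 2 * w D₅.diagram - 1 / 2 * w D₆.diagram
  six_term_second : ∀ (a b d : ℕ) (P Q R S : List ℕ) (D₁ D₂ D₃ D₄ D₅ D₆ : ChordWord),
    D₁.letters = [b, a] ++ P ++ [d] ++ Q ++ [b] ++ R ++ [a, d] ++ S →
    D₂.letters = [a, b] ++ P ++ [d] ++ Q ++ [b] ++ R ++ [a, d] ++ S →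
    D₃.letters = [b, a] ++ P ++ [d] ++ Q ++ [b] ++ R ++ [d, a] ++ S →
    D₄.letters = [a, b] ++ P ++ [d] ++ Q ++ [b] ++ R ++ [d, a] ++ S →
    D₅.letters = [b] ++ P ++ [d] ++ Q ++ [d] ++ R ++ [b] ++ S →
    D₆.letters = [b] ++ P ++ [b] ++ Q ++ [d] ++ R ++ [d] ++ S →
    w D₁.diagram - w D₂.diagram - w D₃.diagram + w D₄.diagram =
      1 / 2 * w D₅.diagram - 1 / 2 * w D₆.diagram

section TraceWeight

variable {A : Type*} [Ring A] [Algebra ℂ A] {X : Fin 3 → A} {μ c : ℂ}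

/-- Both six-term relations for contractions: `W` is the arc between the ends of `a`, and `W'`,
`W''` are the same arc after its ends of `b` and `d` have been renamed. -/
theorem IsSpinTriple.stateSum_six_term (h : IsSpinTriple X μ c) {a b d : ℕ}
    {P Q R S W W' W'' : List ℕ} (hab : a ≠ b) (had : a ≠ d) (hbd : b ≠ d)
    (hn : ∀ x ∈ [a, b, d], x ∉ P ∧ x ∉ Q ∧ x ∉ R ∧ x ∉ S)
    (hW : (W = P ++ b :: (Q ++ d :: R) ∧ W'' = P ++ d :: (Q ++ b :: R)) ∨
      (W = P ++ d :: (Q ++ b :: R) ∧ W'' = P ++ b :: (Q ++ d :: R)))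
    (hW' : W' = P ++ d :: (Q ++ d :: R)) :
    stateSum X (b :: a :: (W ++ a :: d :: S)) - stateSum X (a :: b :: (W ++ a :: d :: S)) -
        stateSum X (b :: a :: (W ++ d :: a :: S)) + stateSum X (a :: b :: (W ++ d :: a :: S)) =
      (1 / 2 : ℂ) • (stateSum X (b :: (W' ++ b :: S)) - stateSum X (b :: (W'' ++ d :: S))) := by
  obtain ⟨haP, haQ, haR, haS⟩ := hn a (by simp)
  obtain ⟨hbP, hbQ, hbR, hbS⟩ := hn b (by simp)
  obtain ⟨hdP, hdQ, hdR, hdS⟩ := hn d (by simp)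
  set L := (P ++ Q ++ R ++ S).dedup with hL
  have hLm : ∀ x, x ∈ L ↔ x ∈ P ∨ x ∈ Q ∨ x ∈ R ∨ x ∈ S := by simp [hL]
  have hLn : L.Nodup := List.nodup_dedup _
  have hn3 : (L ++ [b, d, a]).Nodup := by
    refine List.nodup_append.2 ⟨hLn, by simp [hab.symm, had.symm, hbd], fun x hx y hy e => ?_⟩
    subst e
    rw [hLm] at hx
    have := hn x (by simp at hy ⊢; tauto)
    tauto
  have hn2 : (L ++ [b, d]).Nodup := hn3.sublist (by simp)
  have e3 : ∀ l : List ℕ, l.Perm (a :: a :: b :: b :: d :: d :: (P ++ Q ++ R ++ S)) →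
      stateSum X l = colorSum L (colorSum [b, d, a] (wordProd X l)) 0 := by
    intro l hl
    rw [stateSum_eq X hn3 (fun x => ?_) 0, colorSum_append]
    simp only [hl.mem_iff, List.mem_append, List.mem_cons, hLm, List.not_mem_nil]
    grind only
  have e2 : ∀ l : List ℕ, l.Perm (b :: b :: d :: d :: (P ++ Q ++ R ++ S)) →
      stateSum X l = colorSum L (colorSum [b, d] (wordProd X l)) 0 := by
    intro l hl
    rw [stateSum_eq X hn2 (fun x => ?_) 0, colorSum_append]
    simp only [hl.mem_iff, List.mem_append, List.mem_cons, hLm, List.not_mem_nil]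
    grind only
  have hperm : ∀ l m : List ℕ, (∀ x, l.count x = m.count x) → l.Perm m := fun l m h =>
    List.perm_iff_count.2 h
  have comb : ∀ F₁ F₂ F₃ F₄ F₅ F₆ : (ℕ → Fin 3) → A,
      (∀ f, F₁ f - F₂ f - F₃ f + F₄ f = (1 / 2 : ℂ) • (F₅ f - F₆ f)) →
      colorSum L F₁ 0 - colorSum L F₂ 0 - colorSum L F₃ 0 + colorSum L F₄ 0 =
        (1 / 2 : ℂ) • (colorSum L F₅ 0 - colorSum L F₆ 0) := by
    intro F₁ F₂ F₃ F₄ F₅ F₆ hF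
    have e := congrArg (fun F => colorSum L F 0) (funext hF)
    simpa only [colorSum_add, colorSum_sub, colorSum_smul] using e
  rw [e3 _ ?_, e3 _ ?_, e3 _ ?_, e3 _ ?_, e2 _ ?_, e2 _ ?_]
  · refine comb _ _ _ _ _ _ fun f => ?_
    have key := congrArg (· * wordProd X S f)
      (h.sum_comm_comm fun i j => wordProd X W (Function.update (Function.update f b i) d j))
    have hWa : a ∉ W := by
      rcases hW with ⟨rfl, -⟩ | ⟨rfl, -⟩ <;> simp [haP, haQ, haR, hab, had]
    simp only [Finset.sum_mul, Finset.smul_sum, ] at key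
    simp only [colorSum]
    rw [← Finset.sum_sub_distrib, ← Finset.sum_sub_distrib, ← Finset.sum_sub_distrib,
      ← Finset.sum_add_distrib, Finset.smul_sum]
    convert key using 2 with i _ i _
    · rw [← Finset.sum_sub_distrib, ← Finset.sum_sub_distrib, ← Finset.sum_add_distrib]
      refine Finset.sum_congr rfl fun j _ => ?_
      rw [← Finset.sum_sub_distrib, ← Finset.sum_sub_distrib, ← Finset.sum_add_distrib]
      refine Finset.sum_congr rfl fun k _ => ?_
      simp only [wordProd_cons, wordProd_append, wordProd_update X hWa, wordProd_update X haS,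
        wordProd_update X hbS, wordProd_update X hdS, Function.update_self,
        Function.update_of_ne hab.symm, Function.update_of_ne had.symm,
        Function.update_of_ne hbd]
      noncomm_ring
    · rw [← Finset.sum_sub_distrib, Finset.smul_sum]
      refine Finset.sum_congr rfl fun j _ => ?_
      rcases hW with ⟨rfl, rfl⟩ | ⟨rfl, rfl⟩ <;>
      · subst hW'
        simp only [wordProd_cons, wordProd_append, wordProd_update X hbP, wordProd_update X hbQ,
          wordProd_update X hbR, wordProd_update X hbS, wordProd_update X hdP,
          wordProd_update X hdQ, wordProd_update X hdR, wordProd_update X hdS,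
          Function.update_self, Function.update_of_ne hbd]
        rw [smul_mul_assoc]
        congr 1
        noncomm_ring
  all_goals
    first
    | subst hW'
      refine hperm _ _ fun x => ?_
      simp only [List.count_cons, List.count_append]
      omega
    | rcases hW with ⟨rfl, rfl⟩ | ⟨rfl, rfl⟩ <;>
      · refine hperm _ _ fun x => ?_
        simp only [List.count_cons, List.count_append]
        omega

variable (X)

/-- The value of a trace on the contraction of a chord diagram. -/
noncomputable def traceWeight (t : A →ₗ[ℂ] ℂ) (ht : ∀ a b, t (a * b) = t (b * a)) :
    ChordDiagram → ℂ :=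
  Quotient.lift (fun D : ChordWord => t (stateSum X D.letters)) fun D D' ⟨σ, h⟩ => by
    have := map_stateSum_isRotated X t.toAddMonoidHom ht h
    rw [stateSum_map] at this
    exact this

theorem traceWeight_diagram (t : A →ₗ[ℂ] ℂ) (ht : ∀ a b, t (a * b) = t (b * a))
    (D : ChordWord) : traceWeight X t ht D.diagram = t (stateSum X D.letters) := rfl

variable {X}

/-- A normalized trace of contractions is a numerical weight system if only scalars commute with
the `X k`: then the contraction of a factor, being central, is a scalar, which gives
multiplicativity. -/
theorem IsSpinTriple.isWeightSystemAt (h : IsSpinTriple X μ c) (t : A →ₗ[ℂ] ℂ)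
    (ht : ∀ a b, t (a * b) = t (b * a)) (ht1 : t 1 = 1)
    (hc : ∀ Z : A, (∀ k, X k * Z = Z * X k) → ∃ z : ℂ, Z = z • (1 : A)) :
    IsWeightSystemAt c (traceWeight X t ht) where
  normalization D a hD := by
    rw [traceWeight_diagram, hD, stateSum_eq X (L := [a]) (by simp) (by simp) 0]
    simp [colorSum, h.casimir, ht1]
  multiplicativity D₁ D₂ D hD := by
    have hdisj : ∀ x ∈ D₁.letters, x ∉ D₂.letters := fun x h₁ h₂ => by
      have := D.twice x (by simp [hD, h₁])
      rw [hD, List.count_append, D₁.twice x h₁, D₂.twice x h₂] at this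
      omega
    obtain ⟨z, hz⟩ := hc _ fun k => h.commute_stateSum k D₁.twice
    rw [traceWeight_diagram, traceWeight_diagram, traceWeight_diagram, hD,
      stateSum_append X hdisj, hz]
    simp [ht1]
  leaf_deletion D D' a hb hD' := by
    obtain ⟨b, hb, hbu⟩ := hb
    have haD : a ∈ D.letters := by
      rcases hb.2 with h | h <;> exact h.subset (by simp)
    obtain ⟨U, V, hr, haU, haV⟩ := exists_isRotated_chord (D.twice a haD)
    have hcount : ∀ x, x ∈ U ∨ x ∈ V → U.count x + V.count x = 2 := by
      intro x hx
      have hxa : a ≠ x := by rintro rfl; tauto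
      have := D.count_eq hr (x := x) (by simp; tauto)
      simpa [hxa] using this
    obtain ⟨hbU, hbV⟩ := (interlaced_cons_iff haU haV hb.1.symm).1 (hb.rotated hr)
    have hbc : U.count b = 1 := by
      have := hcount b (Or.inl hbU)
      have := List.count_pos_iff.2 hbU
      have := List.count_pos_iff.2 hbV
      omega
    have hU : ∀ x ∈ U, x = b ∨ (U.count x = 2 ∧ x ∉ V) := by
      intro x hx
      by_cases hxV : x ∈ V
      · exact Or.inl (hbu x (((interlaced_cons_iff haU haV
          (fun e => haU (e ▸ hx))).2 ⟨hx, hxV⟩).rotated hr.symm))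
      · have := hcount x (Or.inl hx)
        rw [List.count_eq_zero_of_not_mem hxV] at this
        exact Or.inr ⟨this, hxV⟩
    have hr' : D'.letters ~r U ++ V := by
      rw [hD']
      have := isRotated_filter hr (fun x => decide (x ≠ a))
      rwa [filter_ne_cons_append_cons haU haV] at this
    rw [traceWeight_diagram, traceWeight_diagram]
    have e₁ := map_stateSum_isRotated X t.toAddMonoidHom ht hr
    have e₂ := map_stateSum_isRotated X t.toAddMonoidHom ht hr'
    simp only [LinearMap.toAddMonoidHom_coe] at e₁ e₂
    rw [e₁, e₂, h.stateSum_leaf haU haV hbc hbV hU, map_smul, smul_eq_mul]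
  six_term_first a b d P Q R S D₁ D₂ D₃ D₄ D₅ D₆ h₁ h₂ h₃ h₄ h₅ h₆ := by
    obtain ⟨hab, had, hbd, hn⟩ := six_term_names (a := a) (b := b) (d := d) (P := P) (Q := Q)
      (R := R) (S := S) D₁.twice (by
        rw [h₁]
        refine List.perm_iff_count.2 fun x => ?_
        simp only [List.count_cons, List.count_append, List.count_nil]
        omega)
    have key := congrArg t (h.stateSum_six_term hab had hbd hn (Or.inl ⟨rfl, rfl⟩) rfl)
    simp only [map_sub, map_add, map_smul, smul_eq_mul] at key
    simp only [traceWeight_diagram, h₁, h₂, h₃, h₄, h₅, h₆, List.append_assoc, List.cons_append,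
      List.nil_append] at key ⊢
    rw [key]
    ring
  six_term_second a b d P Q R S D₁ D₂ D₃ D₄ D₅ D₆ h₁ h₂ h₃ h₄ h₅ h₆ := by
    obtain ⟨hab, had, hbd, hn⟩ := six_term_names (a := a) (b := b) (d := d) (P := P) (Q := Q)
      (R := R) (S := S) D₁.twice (by
        rw [h₁]
        refine List.perm_iff_count.2 fun x => ?_
        simp only [List.count_cons, List.count_append, List.count_nil]
        omega)
    have key := congrArg t (h.stateSum_six_term hab had hbd hn (Or.inr ⟨rfl, rfl⟩) rfl)
    simp only [map_sub, map_add, map_smul, smul_eq_mul] at key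
    simp only [traceWeight_diagram, h₁, h₂, h₃, h₄, h₅, h₆, List.append_assoc, List.cons_append,
      List.nil_append] at key ⊢
    rw [key]
    ring

end TraceWeight

/-! ### The irreducible representations of `sl(2)` -/

section Irreducible

variable (N : ℕ)

/-- The raising operator of the irreducible representation of dimension `N`. -/
def raiseMatrix : Matrix (Fin N) (Fin N) ℂ :=
  Matrix.of fun i j => if (j : ℕ) = i + 1 then ((i : ℂ) + 1) * (N - 1 - i) else 0

/-- The lowering operator of the irreducible representation of dimension `N`. -/
def lowerMatrix : Matrix (Fin N) (Fin N) ℂ :=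
  Matrix.of fun i j => if (i : ℕ) = j + 1 then 1 else 0

/-- The weight operator of the irreducible representation of dimension `N`. -/
def weightMatrix : Matrix (Fin N) (Fin N) ℂ :=
  Matrix.diagonal fun i => (N : ℂ) - 1 - 2 * i

theorem raise_mul_lower : raiseMatrix N * lowerMatrix N =
    Matrix.diagonal fun i : Fin N => ((i : ℂ) + 1) * (N - 1 - i) := by
  ext i j
  simp only [Matrix.mul_apply, raiseMatrix, lowerMatrix, Matrix.of_apply, Matrix.diagonal_apply,
    mul_ite, mul_one, mul_zero]
  by_cases hi : (i : ℕ) + 1 < N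
  · rw [Finset.sum_eq_single (⟨i + 1, hi⟩ : Fin N)]
    · simp [Fin.ext_iff]
    · intro k _ hk
      simp only [ne_eq, Fin.ext_iff] at hk
      simp [hk]
    · simp
  · -- the last basis vector: the coefficient vanishes as well
    have hN : (N : ℂ) = i + 1 := by
      have := i.isLt
      exact_mod_cast (by omega : N = (i : ℕ) + 1)
    rw [Finset.sum_eq_zero, hN]
    · simp
    · intro k _
      have := k.isLt
      have h : ¬ (k : ℕ) = i + 1 := by omega
      simp [h]

theorem lower_mul_raise : lowerMatrix N * raiseMatrix N =
    Matrix.diagonal fun i : Fin N => (i : ℂ) * (N - i) := by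
  ext i j
  simp only [Matrix.mul_apply, raiseMatrix, lowerMatrix, Matrix.of_apply, Matrix.diagonal_apply,
    ite_mul, one_mul, zero_mul]
  rcases i with ⟨_ | i, hi⟩
  · simp
  · rw [Finset.sum_eq_single (⟨i, by omega⟩ : Fin N)]
    · have : (j : ℕ) = i + 1 ↔ i + 1 = (j : ℕ) := eq_comm
      simp only [Fin.ext_iff, this, if_true]
      split_ifs
      · push_cast; ring
      · rfl
    · intro k _ hk
      simp only [ne_eq, Fin.ext_iff] at hk
      have : ¬ i + 1 = (k : ℕ) + 1 := by omega
      rw [if_neg this]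
    · simp

theorem raise_lower_comm :
    raiseMatrix N * lowerMatrix N - lowerMatrix N * raiseMatrix N = weightMatrix N := by
  rw [raise_mul_lower, lower_mul_raise, weightMatrix, Matrix.diagonal_sub]
  congr 1
  funext i
  ring

theorem weight_raise_comm :
    weightMatrix N * raiseMatrix N - raiseMatrix N * weightMatrix N = (2 : ℂ) • raiseMatrix N := by
  ext i j
  simp only [weightMatrix, raiseMatrix, Matrix.sub_apply, Matrix.diagonal_mul,
    Matrix.mul_diagonal, Matrix.smul_apply, Matrix.of_apply]
  split_ifs with h
  · rw [h]; push_cast; simp only [smul_eq_mul]; ring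
  · simp

theorem weight_lower_comm :
    weightMatrix N * lowerMatrix N - lowerMatrix N * weightMatrix N =
      (-2 : ℂ) • lowerMatrix N := by
  ext i j
  simp only [weightMatrix, lowerMatrix, Matrix.sub_apply, Matrix.diagonal_mul,
    Matrix.mul_diagonal, Matrix.smul_apply, Matrix.of_apply]
  split_ifs with h
  · rw [h]; push_cast; simp only [smul_eq_mul]; ring
  · simp

/-- The Casimir element in terms of the raising, lowering and weight operators. -/
theorem casimir_matrix :
    (2 : ℂ) • (raiseMatrix N * lowerMatrix N) + (2 : ℂ) • (lowerMatrix N * raiseMatrix N) +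
      weightMatrix N * weightMatrix N =
    ((N : ℂ) ^ 2 - 1) • (1 : Matrix (Fin N) (Fin N) ℂ) := by
  rw [raise_mul_lower, lower_mul_raise, weightMatrix, Matrix.diagonal_mul_diagonal,
    ← Matrix.diagonal_smul, ← Matrix.diagonal_smul, Matrix.diagonal_add, Matrix.diagonal_add,
    ← Matrix.diagonal_one, ← Matrix.diagonal_smul]
  congr 1
  funext i
  simp only [Pi.smul_apply, smul_eq_mul]
  ring

/-- Schur's lemma for the irreducible representation: weights are distinct, and the lowering
operator connects consecutive weight spaces. -/
theorem eq_smul_one_of_commute {Z : Matrix (Fin N) (Fin N) ℂ}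
    (hH : weightMatrix N * Z = Z * weightMatrix N) (hF : lowerMatrix N * Z = Z * lowerMatrix N) :
    ∃ z : ℂ, Z = z • (1 : Matrix (Fin N) (Fin N) ℂ) := by
  have hoff : ∀ i j, i ≠ j → Z i j = 0 := by
    intro i j hij
    have := congrFun (congrFun hH i) j
    simp only [weightMatrix, Matrix.diagonal_mul, Matrix.mul_diagonal] at this
    have h2 : (2 * ((j : ℂ) - i)) * Z i j = 0 := by linear_combination this
    refine (mul_eq_zero.1 h2).resolve_left ?_
    simp only [mul_eq_zero, OfNat.ofNat_ne_zero, false_or, sub_eq_zero]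
    exact fun e => hij (Fin.ext (by exact_mod_cast e.symm))
  rcases N with _ | n
  · exact ⟨0, by ext i; exact i.elim0⟩
  refine ⟨Z 0 0, ?_⟩
  have hdiag : ∀ (k : ℕ) (hk : k < n + 1), Z ⟨k, hk⟩ ⟨k, hk⟩ = Z 0 0 := by
    intro k
    induction k with
    | zero => intro _; rfl
    | succ k ih =>
      intro hk
      have := congrFun (congrFun hF ⟨k + 1, hk⟩) ⟨k, by omega⟩
      rw [← ih (by omega)]
      simp only [Matrix.mul_apply, lowerMatrix, Matrix.of_apply, ite_mul, one_mul, zero_mul,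
        mul_ite, mul_one, mul_zero] at this
      rw [Finset.sum_eq_single (⟨k, by omega⟩ : Fin (n + 1)),
        Finset.sum_eq_single (⟨k + 1, hk⟩ : Fin (n + 1))] at this
      · simpa using this.symm
      · intro j _ hj
        rw [if_neg fun e => hj (Fin.ext e)]
      · simp
      · intro j _ hj
        rw [if_neg fun e => hj (Fin.ext (by simpa using e.symm))]
      · simp
  ext i j
  by_cases hij : i = j
  · subst hij
    simpa using hdiag i i.isLt
  · simp [hoff i j hij, hij]

/-- The image of an orthonormal basis of `sl(2)` in the irreducible representation of
dimension `N`; the scalar `s` is a square root of `-1/2`. -/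
noncomputable def spinMatrix (s : ℂ) : Fin 3 → Matrix (Fin N) (Fin N) ℂ :=
  ![(-(Complex.I * s / 2)) • (raiseMatrix N + lowerMatrix N),
    (-(s / 2)) • (raiseMatrix N - lowerMatrix N),
    (-(Complex.I * s / 2)) • weightMatrix N]

theorem spinMatrix_isSpinTriple {s : ℂ} (hs : s * s = -(1 / 2)) :
    IsSpinTriple (spinMatrix N s) s (((N : ℂ) ^ 2 - 1) / 8) := by
  have hEF := raise_lower_comm N
  have hHE := weight_raise_comm N
  have hHF := weight_lower_comm N
  have hC := casimir_matrix N
  refine ⟨hs, fun k => ?_, ?_⟩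
  · fin_cases k
    · simp only [spinMatrix, Fin.isValue, Fin.zero_eta, zero_add, Matrix.cons_val,
        smul_mul_smul_comm, ← hEF]
      simp only [add_mul, mul_add, sub_mul, mul_sub]
      module
    · simp only [spinMatrix, Fin.isValue, Fin.mk_one, Fin.reduceAdd, Matrix.cons_val,
        smul_mul_smul_comm]
      have : raiseMatrix N + lowerMatrix N = (1 / 2 : ℂ) •
          ((weightMatrix N * raiseMatrix N - raiseMatrix N * weightMatrix N) -
            (weightMatrix N * lowerMatrix N - lowerMatrix N * weightMatrix N)) := by
        rw [hHE, hHF]; module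
      rw [this]
      simp only [sub_mul, mul_sub]
      module
    · simp only [spinMatrix, Fin.isValue, Fin.reduceFinMk, Fin.reduceAdd, Matrix.cons_val,
        smul_mul_smul_comm]
      have : raiseMatrix N - lowerMatrix N = (1 / 2 : ℂ) •
          ((weightMatrix N * raiseMatrix N - raiseMatrix N * weightMatrix N) +
            (weightMatrix N * lowerMatrix N - lowerMatrix N * weightMatrix N)) := by
        rw [hHE, hHF]; module
      have hI : -(Complex.I * s / 2) * -(Complex.I * s / 2) = -(s * s / 4) := by
        linear_combination (s * s / 4) * Complex.I_mul_I
      rw [this, hI]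
      simp only [add_mul, mul_add]
      module
  · have hI : -(Complex.I * s / 2) * -(Complex.I * s / 2) = 1 / 8 := by
      linear_combination (s * s / 4) * Complex.I_mul_I - 1 / 4 * hs
    have hI' : -(s / 2) * -(s / 2) = -(1 / 8) := by linear_combination 1 / 4 * hs
    have : (((N : ℂ) ^ 2 - 1) / 8) • (1 : Matrix (Fin N) (Fin N) ℂ) =
        (1 / 8 : ℂ) • (((N : ℂ) ^ 2 - 1) • (1 : Matrix (Fin N) (Fin N) ℂ)) := by
      rw [smul_smul]; congr 1; ring
    rw [this, ← hC]
    simp only [spinMatrix, Fin.sum_univ_three, Fin.isValue, Matrix.cons_val, smul_mul_smul_comm,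
      hI, hI']
    simp only [add_mul, mul_add, sub_mul, mul_sub]
    module

theorem eq_smul_one_of_commute_spinMatrix {s : ℂ} (hs : s * s = -(1 / 2))
    {Z : Matrix (Fin N) (Fin N) ℂ} (h : ∀ k, spinMatrix N s k * Z = Z * spinMatrix N s k) :
    ∃ z : ℂ, Z = z • (1 : Matrix (Fin N) (Fin N) ℂ) := by
  have hs0 : s ≠ 0 := by rintro rfl; norm_num at hs
  have hIs : -(Complex.I * s / 2) ≠ 0 := by simp [hs0]
  have hs2 : -(s / 2) ≠ 0 := by simp [hs0]
  have h0 := h 0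
  have h1 := h 1
  have h2 := h 2
  simp only [spinMatrix, Fin.isValue, Matrix.cons_val, smul_mul_assoc, mul_smul_comm] at h0 h1 h2
  have h0 := smul_right_injective _ hIs h0
  have h1 := smul_right_injective _ hs2 h1
  refine eq_smul_one_of_commute N (smul_right_injective _ hIs h2) ?_
  have e : lowerMatrix N = (1 / 2 : ℂ) • ((raiseMatrix N + lowerMatrix N) -
    (raiseMatrix N - lowerMatrix N)) := by module
  rw [e, smul_mul_assoc, mul_smul_comm, sub_mul, mul_sub, h0, h1]

/-- The trace, normalized to be one on the identity matrix. -/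
noncomputable def normalizedTrace : Matrix (Fin N) (Fin N) ℂ →ₗ[ℂ] ℂ :=
  ((N : ℂ)⁻¹) • Matrix.traceLinearMap (Fin N) ℂ ℂ

theorem normalizedTrace_mul_comm (a b : Matrix (Fin N) (Fin N) ℂ) :
    normalizedTrace N (a * b) = normalizedTrace N (b * a) := by
  simp [normalizedTrace, Matrix.trace_mul_comm a b]

theorem normalizedTrace_one (hN : N ≠ 0) : normalizedTrace N 1 = 1 := by
  simp [normalizedTrace, hN]

theorem exists_mul_self_eq_neg_half : ∃ s : ℂ, s * s = -(1 / 2) := by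
  obtain ⟨s, hs⟩ := IsAlgClosed.exists_pow_nat_eq (-(1 / 2) : ℂ) two_pos
  exact ⟨s, by rw [← hs, sq]⟩

variable {N} in
theorem isWeightSystemAt_irreducible (hN : N ≠ 0) {s : ℂ} (hs : s * s = -(1 / 2)) :
    IsWeightSystemAt (((N : ℂ) ^ 2 - 1) / 8)
      (traceWeight (spinMatrix N s) (normalizedTrace N) (normalizedTrace_mul_comm N)) :=
  (spinMatrix_isSpinTriple N hs).isWeightSystemAt _ _ (normalizedTrace_one N hN)
    fun _ => eq_smul_one_of_commute_spinMatrix N hs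

end Irreducible

/-! ### The axioms determine the values -/

/-- The axioms force the value of every numerical weight system on `D` to be the value of a
fixed polynomial. -/
def IsDetermined (D : ChordDiagram) : Prop :=
  ∃ p : Polynomial ℂ, ∀ (c : ℂ) (w : ChordDiagram → ℂ), c ≠ 0 → IsWeightSystemAt c w →
    w D = p.eval c

/-- A word in which every letter that occurs does so twice, as a chord word. -/
theorem exists_chordWord {l : List ℕ} (h : ∀ x ∈ l, l.count x = 2) :
    ∃ D : ChordWord, D.letters = l := ⟨⟨l, h⟩, rfl⟩

theorem exists_chordWord_perm {D : ChordWord} {l : List ℕ} (h : l.Perm D.letters) :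
    ∃ D' : ChordWord, D'.letters = l :=
  exists_chordWord fun x hx => by rw [h.count_eq]; exact D.twice x (h.mem_iff.1 hx)

/-- The empty diagram has the value `1`: multiplicativity gives `c * w ∅ = c`, and `c ≠ 0`. -/
theorem isDetermined_nil {D : ChordWord} (h : D.letters = []) : IsDetermined D.diagram := by
  refine ⟨1, fun c w hc hw => ?_⟩
  obtain ⟨D₁, h₁⟩ := exists_chordWord (l := [0, 0]) (by simp)
  have e₁ := hw.normalization D₁ 0 h₁
  have e₂ := hw.multiplicativity D₁ D D₁ (by simp [h])
  rw [e₁] at e₂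
  have := mul_left_cancel₀ hc ((mul_one c).trans e₂)
  simp [← this]

/-- The word has a chord such that one of the two arcs between its ends carries exactly `n`
ends of other chords. -/
def HasArc (D : ChordWord) (n : ℕ) : Prop :=
  ∃ a U V, D.letters ~r a :: (U ++ a :: V) ∧ U.length = n

theorem isDetermined_of_isRotated {D D' : ChordWord} (h : D.letters ~r D'.letters)
    (hD : IsDetermined D'.diagram) : IsDetermined D.diagram := by
  rwa [diagram_eq_of_isRotated h]

theorem isDetermined_of_six {D D₁ D₂ D₃ D₄ D₅ : ChordDiagram}
    (h : ∀ (c : ℂ) (w : ChordDiagram → ℂ), IsWeightSystemAt c w →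
      w D - w D₁ - w D₂ + w D₃ = 1 / 2 * w D₄ - 1 / 2 * w D₅)
    (h₁ : IsDetermined D₁) (h₂ : IsDetermined D₂) (h₃ : IsDetermined D₃) (h₄ : IsDetermined D₄)
    (h₅ : IsDetermined D₅) : IsDetermined D := by
  obtain ⟨p₁, h₁⟩ := h₁
  obtain ⟨p₂, h₂⟩ := h₂
  obtain ⟨p₃, h₃⟩ := h₃
  obtain ⟨p₄, h₄⟩ := h₄
  obtain ⟨p₅, h₅⟩ := h₅
  refine ⟨p₁ + p₂ - p₃ + Polynomial.C (1 / 2) * p₄ - Polynomial.C (1 / 2) * p₅,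
    fun c w hc hw => ?_⟩
  have := h c w hw
  rw [h₁ c w hc hw, h₂ c w hc hw, h₃ c w hc hw, h₄ c w hc hw, h₅ c w hc hw] at this
  simp only [Polynomial.eval_add, Polynomial.eval_sub, Polynomial.eval_mul, Polynomial.eval_C]
  linear_combination this

theorem isRotated_of_eq_append {l m s t : List ℕ} (hl : l = s ++ t) (hm : m = t ++ s) :
    l ~r m := by subst hl hm; exact List.isRotated_append

/-- The induction step. The arc of `a` is taken as short as possible, so it meets no chord twice.
If it meets at least two chords, then the six-term relation for its two extreme chords expresses
the value through diagrams in which the arc of `a` is shorter and diagrams with fewer chords. -/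
theorem isDetermined_of_hasArc {D : ChordWord} {n : ℕ} (hD : HasArc D n)
    (hlt : ∀ D' : ChordWord, D'.letters.length < D.letters.length → IsDetermined D'.diagram)
    (harc : ∀ (D' : ChordWord) (m : ℕ), D'.letters.length = D.letters.length → m < n →
      HasArc D' m → IsDetermined D'.diagram) : IsDetermined D.diagram := by
  obtain ⟨a, U, V, hr, rfl⟩ := hD
  have hlen := hr.perm.length_eq
  have hcount : ∀ x ∈ a :: (U ++ a :: V), (a :: (U ++ a :: V)).count x = 2 :=
    fun x hx => D.count_eq hr hx
  have ha := hcount a (by simp)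
  simp only [List.count_cons_self, List.count_append] at ha
  have haU : a ∉ U := List.count_eq_zero.1 (by omega)
  have haV : a ∉ V := List.count_eq_zero.1 (by omega)
  have hUV : ∀ x, x ∈ U ∨ x ∈ V → U.count x + V.count x = 2 := by
    intro x hx
    have hxa : a ≠ x := by rintro rfl; tauto
    have := hcount x (by simp; tauto)
    simpa [hxa] using this
  by_cases hdup : ∃ x, U.count x = 2
  · obtain ⟨x, hx⟩ := hdup
    obtain ⟨U₁, U₂, U₃, rfl, -, -, -⟩ := exists_eq_of_count_eq_two hx
    refine harc D U₂.length rfl (by simp; omega)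
      ⟨x, U₂, U₃ ++ a :: (V ++ a :: U₁), hr.trans ?_, rfl⟩
    exact isRotated_of_eq_append (s := a :: U₁) (t := x :: (U₂ ++ x :: (U₃ ++ a :: V)))
      (by simp) (by simp)
  have hone : ∀ x ∈ U, U.count x = 1 ∧ V.count x = 1 := by
    intro x hx
    have h₁ := hUV x (Or.inl hx)
    have h₂ := List.count_pos_iff.2 hx
    have h₃ : U.count x ≠ 2 := fun h => hdup ⟨x, h⟩
    have : V.count x ≠ 0 := by omega
    omega
  obtain ⟨D₁, hD₁⟩ := exists_chordWord hcount
  refine isDetermined_of_isRotated (D' := D₁) (hD₁ ▸ hr) ?_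
  clear hdup
  rcases U with _ | ⟨d, T⟩
  · -- an isolated chord
    obtain ⟨D₂, hD₂⟩ := exists_chordWord (l := [a, a]) (by simp)
    obtain ⟨D₃, hD₃⟩ := exists_chordWord (l := V) fun x hx => by simpa using hUV x (Or.inr hx)
    obtain ⟨p, hp⟩ := hlt D₃ (by simp [hlen, hD₃])
    refine ⟨Polynomial.X * p, fun c w hc hw => ?_⟩
    rw [hw.multiplicativity D₂ D₃ D₁ (by simp [hD₁, hD₂, hD₃]), hw.normalization D₂ a hD₂,
      hp c w hc hw]
    simp
  rcases T.eq_nil_or_concat' with rfl | ⟨S, b, rfl⟩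
  · -- a chord that intersects exactly one other chord
    obtain ⟨hd₁, hd₂⟩ := hone d (by simp)
    have hda : d ≠ a := by rintro rfl; simp at haU
    have hdV : d ∈ V := List.count_pos_iff.1 (by omega)
    obtain ⟨D₂, hD₂⟩ := exists_chordWord (l := d :: V) fun x hx => by
      have := hUV x (by simpa using hx)
      rw [← this, ← List.count_append]
      rfl
    obtain ⟨p, hp⟩ := hlt D₂ (by simp [hlen, hD₂])
    refine ⟨(Polynomial.X - Polynomial.C (1 / 2)) * p, fun c w hc hw => ?_⟩
    rw [hw.leaf_deletion D₁ D₂ a ?_ ?_, hp c w hc hw]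
    · simp
    · refine ⟨d, ?_, fun y hy => ?_⟩
      · change Interlaced D₁.letters a d
        rw [hD₁]
        exact (interlaced_cons_iff haU haV hda).2 ⟨by simp, hdV⟩
      · change Interlaced D₁.letters a y at hy
        rw [hD₁] at hy
        have := (interlaced_cons_iff haU haV hy.1.symm).1 hy
        simpa using this.1
    · rw [hD₁, hD₂]
      exact (filter_ne_cons_append_cons haU haV).symm
  · -- at least two chords cross the arc of `a`; `d` and `b` are the extreme ones
    obtain ⟨hd₁, hd₂⟩ := hone d (by simp)
    obtain ⟨hb₁, hb₂⟩ := hone b (by simp)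
    have hbd : b ≠ d := by
      rintro rfl
      simp at hb₁
    obtain ⟨V₁, V₂, rfl, -, -⟩ := exists_eq_of_count_eq_one hb₂
    -- the other end of `d` lies before or after the other end of `b`
    have hd : d ∈ V₁ ∨ d ∈ V₂ := by
      have : d ∈ V₁ ++ b :: V₂ := List.count_pos_iff.1 (by omega)
      simpa [hbd.symm] using this
    obtain ⟨E₁, hE₁⟩ := exists_chordWord_perm (D := D₁)
      (l := b :: a :: (V₁ ++ b :: V₂ ++ a :: d :: S)) (by
        rw [hD₁, List.perm_iff_count]
        intro x
        simp only [List.count_cons, List.count_append, List.count_nil]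
        omega)
    obtain ⟨E₂, hE₂⟩ := exists_chordWord_perm (D := E₁)
      (l := a :: b :: (V₁ ++ b :: V₂ ++ a :: d :: S)) (by
        rw [hE₁, List.perm_iff_count]
        intro x
        simp only [List.count_cons, List.count_append]
        omega)
    obtain ⟨E₃, hE₃⟩ := exists_chordWord_perm (D := E₁)
      (l := b :: a :: (V₁ ++ b :: V₂ ++ d :: a :: S)) (by
        rw [hE₁, List.perm_iff_count]
        intro x
        simp only [List.count_cons, List.count_append]
        omega)
    obtain ⟨E₄, hE₄⟩ := exists_chordWord_perm (D := E₁)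
      (l := a :: b :: (V₁ ++ b :: V₂ ++ d :: a :: S)) (by
        rw [hE₁, List.perm_iff_count]
        intro x
        simp only [List.count_cons, List.count_append]
        omega)
    have r₁ : D₁.letters ~r E₁.letters := isRotated_of_eq_append
      (s := a :: (d :: S)) (t := b :: a :: (V₁ ++ b :: V₂)) (by simp [hD₁]) (by simp [hE₁])
    have r₂ : E₂.letters ~r a :: (d :: S ++ a :: (b :: (V₁ ++ b :: V₂))) := isRotated_of_eq_append
      (s := a :: b :: (V₁ ++ b :: V₂)) (t := a :: d :: S) (by simp [hE₂]) (by simp)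
    have r₃ : E₃.letters ~r a :: ((S ++ [b]) ++ a :: (V₁ ++ b :: V₂ ++ [d])) :=
      isRotated_of_eq_append (s := b :: a :: (V₁ ++ b :: V₂ ++ [d])) (t := a :: S)
        (by simp [hE₃]) (by simp)
    have r₄ : E₄.letters ~r a :: (S ++ a :: (b :: (V₁ ++ b :: V₂ ++ [d]))) :=
      isRotated_of_eq_append (s := a :: b :: (V₁ ++ b :: V₂ ++ [d])) (t := a :: S)
        (by simp [hE₄]) (by simp)
    have g₂ := harc E₂ _ (by simp [hlen, hE₂]; omega) (by simp) ⟨a, _, _, r₂, rfl⟩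
    have g₃ := harc E₃ _ (by simp [hlen, hE₃]; omega) (by simp) ⟨a, _, _, r₃, rfl⟩
    have g₄ := harc E₄ _ (by simp [hlen, hE₄]; omega) (by simp) ⟨a, _, _, r₄, rfl⟩
    refine isDetermined_of_isRotated r₁ ?_
    have hE : ∀ l : List ℕ, (a :: a :: l).Perm E₁.letters → ∃ D' : ChordWord,
        D'.letters = l ∧ IsDetermined D'.diagram := by
      intro l hl
      have hal : a ∉ l := by
        have h1 := hl.count_eq a
        rw [E₁.twice a (by simp [hE₁])] at h1
        simp only [List.count_cons_self] at h1
        exact List.count_eq_zero.1 (by omega)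
      obtain ⟨D', hD'⟩ := exists_chordWord (l := l) fun x hx => by
        have hxa : a ≠ x := fun e => hal (e ▸ hx)
        have h1 := hl.count_eq x
        rw [E₁.twice x (hl.subset (by simp [hx]))] at h1
        simpa [hxa] using h1
      refine ⟨D', hD', hlt D' ?_⟩
      have h1 := hl.length_eq
      have h2 := r₁.perm.length_eq
      rw [hD₁] at h2
      rw [hD', hlen, h2, ← h1]
      simp
    rcases hd with hd | hd
    · obtain ⟨P, Q, rfl⟩ := List.append_of_mem hd
      obtain ⟨E₅, hE₅, g₅⟩ := hE ([b] ++ P ++ [d] ++ Q ++ [d] ++ V₂ ++ [b] ++ S) (by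
        rw [hE₁, List.perm_iff_count]
        intro x
        simp only [List.count_cons, List.count_append, List.count_nil]
        omega)
      obtain ⟨E₆, hE₆, g₆⟩ := hE ([b] ++ P ++ [b] ++ Q ++ [d] ++ V₂ ++ [d] ++ S) (by
        rw [hE₁, List.perm_iff_count]
        intro x
        simp only [List.count_cons, List.count_append, List.count_nil]
        omega)
      exact isDetermined_of_six (fun c w hw => hw.six_term_second a b d P Q V₂ S E₁ E₂ E₃ E₄ E₅ E₆
        (by simp [hE₁]) (by simp [hE₂]) (by simp [hE₃]) (by simp [hE₄]) hE₅ hE₆)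
        g₂ g₃ g₄ g₅ g₆
    · obtain ⟨Q, R, rfl⟩ := List.append_of_mem hd
      obtain ⟨E₅, hE₅, g₅⟩ := hE ([b] ++ V₁ ++ [d] ++ Q ++ [d] ++ R ++ [b] ++ S) (by
        rw [hE₁, List.perm_iff_count]
        intro x
        simp only [List.count_cons, List.count_append, List.count_nil]
        omega)
      obtain ⟨E₆, hE₆, g₆⟩ := hE ([b] ++ V₁ ++ [d] ++ Q ++ [b] ++ R ++ [d] ++ S) (by
        rw [hE₁, List.perm_iff_count]
        intro x
        simp only [List.count_cons, List.count_append, List.count_nil]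
        omega)
      exact isDetermined_of_six (fun c w hw => hw.six_term_first a b d V₁ Q R S E₁ E₂ E₃ E₄ E₅ E₆
        (by simp [hE₁]) (by simp [hE₂]) (by simp [hE₃]) (by simp [hE₄]) hE₅ hE₆)
        g₂ g₃ g₄ g₅ g₆

theorem isDetermined (D : ChordDiagram) : IsDetermined D := by
  induction D using Quotient.inductionOn with | _ D =>
  change IsDetermined D.diagram
  induction hn : D.letters.length using Nat.strong_induction_on generalizing D with | _ n ihn =>
  have hlt : ∀ D' : ChordWord, D'.letters.length < n → IsDetermined D'.diagram :=
    fun D' h => ihn _ h D' rfl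
  have harc : ∀ (m : ℕ) (D : ChordWord), D.letters.length = n → HasArc D m →
      IsDetermined D.diagram := by
    intro m
    induction m using Nat.strong_induction_on with | _ m ihm =>
    intro D hD hDm
    exact isDetermined_of_hasArc hDm (fun D' h => hlt D' (hD ▸ h))
      fun D' k hD' hk hk' => ihm k hk D' (hD'.trans hD) hk'
  rcases hl : D.letters with _ | ⟨a, l⟩
  · exact isDetermined_nil hl
  · obtain ⟨U, V, hr, -, -⟩ := exists_isRotated_chord (D.twice a (by simp [hl]))
    exact harc _ D hn ⟨a, U, V, hr, rfl⟩

/-! ### Existence and uniqueness of the `sl(2)`-weight system -/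

theorem IsSl2WeightSystem.eval {w : ChordDiagram → Polynomial ℂ} (hw : IsSl2WeightSystem w)
    (c : ℂ) : IsWeightSystemAt c fun D => (w D).eval c where
  normalization D a h := by rw [hw.normalization D a h]; simp
  multiplicativity D₁ D₂ D h := by rw [hw.multiplicativity D₁ D₂ D h]; simp
  leaf_deletion D D' a h h' := by rw [hw.leaf_deletion D D' a h h']; simp
  six_term_first a b d P Q R S D₁ D₂ D₃ D₄ D₅ D₆ h₁ h₂ h₃ h₄ h₅ h₆ := by
    simpa using congrArg (Polynomial.eval c)
      (hw.six_term_first a b d P Q R S D₁ D₂ D₃ D₄ D₅ D₆ h₁ h₂ h₃ h₄ h₅ h₆)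
  six_term_second a b d P Q R S D₁ D₂ D₃ D₄ D₅ D₆ h₁ h₂ h₃ h₄ h₅ h₆ := by
    simpa using congrArg (Polynomial.eval c)
      (hw.six_term_second a b d P Q R S D₁ D₂ D₃ D₄ D₅ D₆ h₁ h₂ h₃ h₄ h₅ h₆)

theorem infinite_nonzero_numbers : {c : ℂ | c ≠ 0}.Infinite :=
  (Set.finite_singleton (0 : ℂ)).infinite_compl

theorem infinite_casimir_values :
    {c : ℂ | c ≠ 0 ∧ ∃ N : ℕ, N ≠ 0 ∧ c = ((N : ℂ) ^ 2 - 1) / 8}.Infinite := by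
  refine Set.infinite_of_injective_forall_mem (f := fun n : ℕ => (((n + 2 : ℕ) : ℂ) ^ 2 - 1) / 8)
    (fun m n h => ?_) fun n => ⟨?_, n + 2, by omega, rfl⟩
  · have h : ((m + 2 : ℕ) : ℂ) ^ 2 = ((n + 2 : ℕ) : ℂ) ^ 2 := by
      simp only at h; linear_combination 8 * h
    have h : (m + 2) ^ 2 = (n + 2) ^ 2 := by exact_mod_cast h
    have := Nat.pow_left_injective two_ne_zero h
    omega
  · intro h
    have h : (((n + 2 : ℕ) : ℂ)) ^ 2 = 1 := by linear_combination 8 * h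
    have h : (n + 2) ^ 2 = 1 := by exact_mod_cast h
    have := pow_eq_one_iff.1 h
    omega

/-- The polynomial that gives the values of all numerical weight systems on a diagram. -/
noncomputable def universalWeight (D : ChordDiagram) : Polynomial ℂ := (isDetermined D).choose

theorem IsWeightSystemAt.eq_eval {c : ℂ} {w : ChordDiagram → ℂ} (hw : IsWeightSystemAt c w)
    (hc : c ≠ 0) (D : ChordDiagram) : w D = (universalWeight D).eval c :=
  (isDetermined D).choose_spec c w hc hw

theorem IsSl2WeightSystem.eq_universalWeight {w : ChordDiagram → Polynomial ℂ}
    (hw : IsSl2WeightSystem w) : w = universalWeight := by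
  funext D
  refine Polynomial.eq_of_infinite_eval_eq _ _ (infinite_nonzero_numbers.mono fun c hc => ?_)
  exact (hw.eval c).eq_eval hc D

theorem universalWeight_isWeightSystemAt {N : ℕ} (hN : N ≠ 0) (hc : ((N : ℂ) ^ 2 - 1) / 8 ≠ 0) :
    IsWeightSystemAt (((N : ℂ) ^ 2 - 1) / 8)
      fun D => (universalWeight D).eval (((N : ℂ) ^ 2 - 1) / 8) := by
  obtain ⟨s, hs⟩ := exists_mul_self_eq_neg_half
  have h := isWeightSystemAt_irreducible hN hs
  rwa [show traceWeight (spinMatrix N s) (normalizedTrace N) (normalizedTrace_mul_comm N) =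
    fun D => (universalWeight D).eval (((N : ℂ) ^ 2 - 1) / 8) from funext (h.eq_eval hc)] at h

/-- An identity of polynomials may be checked at the Casimir values of the irreducible
representations, where the polynomials `universalWeight` form a weight system. -/
theorem eq_of_eval_eq {p q : Polynomial ℂ}
    (h : ∀ c, IsWeightSystemAt c (fun D => (universalWeight D).eval c) → p.eval c = q.eval c) :
    p = q := by
  refine Polynomial.eq_of_infinite_eval_eq _ _ (infinite_casimir_values.mono ?_)
  rintro c ⟨hc, N, hN, rfl⟩
  exact h _ (universalWeight_isWeightSystemAt hN hc)

/-- The universal polynomials satisfy the axioms, since they do so at infinitely many points. -/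
theorem universalWeight_isSl2WeightSystem : IsSl2WeightSystem universalWeight where
  normalization D a h := eq_of_eval_eq fun c hc => by simpa using hc.normalization D a h
  multiplicativity D₁ D₂ D h := eq_of_eval_eq fun c hc => by
    simpa using hc.multiplicativity D₁ D₂ D h
  leaf_deletion D D' a h h' := eq_of_eval_eq fun c hc => by
    simpa using hc.leaf_deletion D D' a h h'
  six_term_first a b d P Q R S D₁ D₂ D₃ D₄ D₅ D₆ h₁ h₂ h₃ h₄ h₅ h₆ :=
    eq_of_eval_eq fun c hc => by
      simpa using hc.six_term_first a b d P Q R S D₁ D₂ D₃ D₄ D₅ D₆ h₁ h₂ h₃ h₄ h₅ h₆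
  six_term_second a b d P Q R S D₁ D₂ D₃ D₄ D₅ D₆ h₁ h₂ h₃ h₄ h₅ h₆ :=
    eq_of_eval_eq fun c hc => by
      simpa using hc.six_term_second a b d P Q R S D₁ D₂ D₃ D₄ D₅ D₆ h₁ h₂ h₃ h₄ h₅ h₆

theorem existsUnique_isSl2WeightSystem :
    ∃! w : ChordDiagram → Polynomial ℂ, IsSl2WeightSystem w :=
  ⟨universalWeight, universalWeight_isSl2WeightSystem, fun _ hw => hw.eq_universalWeight⟩

/-! ### `phi` as a sum of signs over colorings -/

/-- The pairs in `insert a s` are those that contain `a` and those in `s`. -/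
theorem prod_sym2_insert {V : Type*} [DecidableEq V] (τ : Sym2 V → ℂ) {a : V} {s : Finset V}
    (ha : a ∉ s) : ∏ e ∈ (insert a s).sym2, τ e =
      τ s(a, a) * (∏ b ∈ s, τ s(a, b)) * ∏ e ∈ s.sym2, τ e := by
  rw [Finset.sym2_insert, Finset.prod_union, Finset.prod_image, Finset.prod_insert ha]
  · exact fun x _ y _ h => Sym2.congr_right.1 h
  · rw [Finset.disjoint_left]
    intro e he he'
    obtain ⟨b, -, rfl⟩ := Finset.mem_image.1 he
    exact ha (Finset.mem_sym2_iff.1 he' a (by simp))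

theorem prod_sym2_union {V : Type*} [DecidableEq V] (τ : Sym2 V → ℂ) {s t : Finset V}
    (h : Disjoint s t) : ∏ e ∈ (s ∪ t).sym2, τ e =
      (∏ e ∈ s.sym2, τ e) * (∏ a ∈ s, ∏ b ∈ t, τ s(a, b)) * ∏ e ∈ t.sym2, τ e := by
  induction s using Finset.induction_on with
  | empty => simp
  | insert a s ha ih =>
    rw [Finset.disjoint_insert_left] at h
    have hat : a ∉ s ∪ t := by simp [ha, h.1]
    rw [Finset.insert_union, prod_sym2_insert τ hat, prod_sym2_insert τ ha, ih h.2,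
      Finset.prod_union h.2, Finset.prod_insert ha]
    ring

open Classical in
/-- The sign of a pair of vertices under a coloring: edges count, and they count `1` when their
ends have the same color and `-1` otherwise. -/
noncomputable def pairSign {V : Type*} (G : SimpleGraph V) (c : V → Fin 3) (e : Sym2 V) : ℂ :=
  if e ∈ G.edgeSet then (if (e.map c).IsDiag then 1 else -1) else 1

/-- The sign of an edge whose ends have the colors `i` and `j`. -/
def edgeSign (i j : Fin 3) : ℂ := if i = j then 1 else -1

open Classical in
@[simp] theorem pairSign_mk {V : Type*} (G : SimpleGraph V) (c : V → Fin 3) (u v : V) :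
    pairSign G c s(u, v) = if G.Adj u v then edgeSign (c u) (c v) else 1 := by
  simp only [pairSign, edgeSign, SimpleGraph.mem_edgeSet, Sym2.map_mk, Sym2.mk_isDiag_iff]

/-- The product of the signs of all edges. -/
noncomputable def coloringSign {V : Type*} [Fintype V] (G : SimpleGraph V) (c : V → Fin 3) : ℂ :=
  ∏ e ∈ Finset.univ.sym2, pairSign G c e

open Classical in
theorem chi3_eq_card {V : Type} [Fintype V] [DecidableEq V] {E : Finset (Sym2 V)}
    (hE : ∀ e ∈ E, ¬ e.IsDiag) :
    (chi3 (SimpleGraph.fromEdgeSet (E : Set (Sym2 V))) : ℂ) =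
      ∑ c : V → Fin 3, if ∀ e ∈ E, ¬ (e.map c).IsDiag then 1 else 0 := by
  rw [Finset.sum_boole, chi3]
  congr 1
  rw [← Fintype.card_subtype, ← Nat.card_eq_fintype_card]
  refine Nat.card_congr
    { toFun := fun c => ⟨c, fun e he => ?_⟩
      invFun := fun c => ⟨c.1, fun {u v} huv => ?_⟩
      left_inv := fun c => rfl
      right_inv := fun c => rfl }
  · induction e with
    | _ u v =>
      intro h
      have hE' := hE _ he
      simp only [Sym2.map_mk, Sym2.mk_isDiag_iff] at h hE'
      exact c.valid ((SimpleGraph.fromEdgeSet_adj _).2 ⟨he, hE'⟩) h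
  · have := (SimpleGraph.fromEdgeSet_adj _).1 huv
    simpa using c.2 _ this.1

/-- Expanding `∏ (1 + (sign - 1))` over the edges shows that `phi` is, up to normalization, the
sum over all colorings with three colors, proper or not, of the product of the edge signs. -/
theorem phiSum_eq {V : Type} [Fintype V] [DecidableEq V] (G : SimpleGraph V) :
    phiSum G = ((8 : ℂ) ^ Fintype.card V)⁻¹ * ∑ c : V → Fin 3, coloringSign G c := by
  classical
  rw [phiSum, Nat.card_eq_fintype_card, pow_mul, show (2 : ℂ) ^ 3 = 8 by norm_num]
  congr 1
  have hsign : ∀ c : V → Fin 3, coloringSign G c =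
      ∑ E ∈ (edges G).powerset, ∏ e ∈ E, (pairSign G c e - 1) := by
    intro c
    rw [← Finset.prod_one_add, coloringSign]
    simp only [add_sub_cancel]
    refine (Finset.prod_subset (fun e _ => by simp) fun e _ he => ?_).symm
    rw [pairSign, if_neg]
    simpa [edges] using he
  simp only [hsign]
  rw [Finset.sum_comm]
  refine Finset.sum_congr rfl fun E hE => ?_
  have hE : ∀ e ∈ E, e ∈ G.edgeSet := fun e he => by
    simpa [edges] using Finset.mem_powerset.1 hE he
  rw [chi3_eq_card fun e he => G.not_isDiag_of_mem_edgeSet (hE e he), Finset.mul_sum]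
  refine Finset.sum_congr rfl fun c _ => ?_
  split_ifs with h
  · rw [Finset.prod_congr rfl (g := fun _ => (-2 : ℂ)), Finset.prod_const, mul_one]
    intro e he
    rw [pairSign, if_pos (hE e he), if_neg (h e he)]
    norm_num
  · push Not at h
    obtain ⟨e, he, hd⟩ := h
    rw [mul_zero, Finset.prod_eq_zero he]
    rw [pairSign, if_pos (hE e he), if_pos hd, sub_self]

open Classical in
theorem coloringSign_sum {V W : Type*} [Fintype V] [Fintype W] (G : SimpleGraph (V ⊕ W))
    (g : V → Fin 3) (f : W → Fin 3) :
    coloringSign G (Sum.elim g f) =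
      coloringSign (G.comap Sum.inl) g *
        (∏ v, ∏ w, if G.Adj (.inl v) (.inr w) then edgeSign (g v) (f w) else 1) *
        coloringSign (G.comap Sum.inr) f := by
  have hu : (Finset.univ : Finset (V ⊕ W)) =
      Finset.univ.image Sum.inl ∪ Finset.univ.image Sum.inr := by
    ext (v | w) <;> simp
  have hd : Disjoint (Finset.univ.image (Sum.inl : V → V ⊕ W))
      (Finset.univ.image (Sum.inr : W → V ⊕ W)) := by
    rw [Finset.disjoint_left]
    simp
  rw [coloringSign, hu, prod_sym2_union _ hd, Finset.sym2_image, Finset.sym2_image,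
    Finset.prod_image, Finset.prod_image, Finset.prod_image]
  · congr 1
    · congr 1
      · refine Finset.prod_congr rfl fun e _ => ?_
        induction e with | _ u v => simp
      · refine Finset.prod_congr rfl fun v _ => ?_
        rw [Finset.prod_image Sum.inr_injective.injOn]
        simp
    · refine Finset.prod_congr rfl fun e _ => ?_
      induction e with | _ u v => simp
  · exact (Sym2.map.injective Sum.inr_injective).injOn
  · exact Sum.inl_injective.injOn
  · exact (Sym2.map.injective Sum.inl_injective).injOn

theorem sum_sum_elim {V W : Type*} [Fintype V] [Fintype W] [DecidableEq V] [DecidableEq W]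
    (F : (V ⊕ W → Fin 3) → ℂ) : ∑ c, F c = ∑ f : W → Fin 3, ∑ g : V → Fin 3, F (Sum.elim g f) := by
  rw [Finset.sum_comm, ← Fintype.sum_prod_type']
  exact Fintype.sum_equiv (Equiv.sumArrowEquivProdArrow V W (Fin 3)) _ _ fun c => by
    congr 1
    funext x
    rcases x with v | w <;> rfl

/-! ### Signs of neighbourhoods -/

open Classical in
/-- The product of the signs of the edges from a vertex of color `i` to the vertices of `a`. -/
noncomputable def nbhdSign {V : Type*} [Fintype V] (f : V → Fin 3) (a : Set V) (i : Fin 3) : ℂ :=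
  ∏ v, if v ∈ a then edgeSign i (f v) else 1

theorem edgeSign_mul_self (i j : Fin 3) : edgeSign i j * edgeSign i j = 1 := by
  unfold edgeSign; split_ifs <;> norm_num

theorem edgeSign_values : edgeSign 0 0 = 1 ∧ edgeSign 0 1 = -1 ∧ edgeSign 0 2 = -1 ∧
    edgeSign 1 0 = -1 ∧ edgeSign 1 1 = 1 ∧ edgeSign 1 2 = -1 ∧
    edgeSign 2 0 = -1 ∧ edgeSign 2 1 = -1 ∧ edgeSign 2 2 = 1 := by
  simp [edgeSign]

section NbhdSign

variable {V : Type*} [Fintype V] (f : V → Fin 3)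

theorem nbhdSign_mul_self (a : Set V) (i : Fin 3) : nbhdSign f a i * nbhdSign f a i = 1 := by
  rw [nbhdSign, ← Finset.prod_mul_distrib]
  exact Finset.prod_eq_one fun v _ => by split_ifs <;> simp [edgeSign_mul_self]

theorem nbhdSign_symmDiff (a b : Set V) (i : Fin 3) :
    nbhdSign f (a ∆ b) i = nbhdSign f a i * nbhdSign f b i := by
  rw [nbhdSign, nbhdSign, nbhdSign, ← Finset.prod_mul_distrib]
  refine Finset.prod_congr rfl fun v _ => ?_
  by_cases ha : v ∈ a <;> by_cases hb : v ∈ b <;>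
    simp [Set.mem_symmDiff, ha, hb, edgeSign_mul_self]

/-- A vertex has the sign `1` for one color and the sign `-1` for the two others. -/
theorem nbhdSign_two (a : Set V) : nbhdSign f a 2 = nbhdSign f a 0 * nbhdSign f a 1 := by
  rw [nbhdSign, nbhdSign, nbhdSign, ← Finset.prod_mul_distrib]
  refine Finset.prod_congr rfl fun v _ => ?_
  split_ifs
  · generalize f v = k
    fin_cases k <;> simp [edgeSign]
  · simp

theorem nbhdSign_eq_or (a : Set V) (i : Fin 3) : nbhdSign f a i = 1 ∨ nbhdSign f a i = -1 :=
  mul_self_eq_one_iff.1 (nbhdSign_mul_self f a i)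

end NbhdSign

theorem phiSum_attach {V : Type} [Fintype V] [DecidableEq V] {k : ℕ} (K : SimpleGraph (Fin k))
    (N : Fin k → Set V) (H : SimpleGraph V) :
    phiSum (attach K N H) = ((8 : ℂ) ^ k)⁻¹ * ((8 : ℂ) ^ Fintype.card V)⁻¹ *
      ∑ f : V → Fin 3, (∑ g : Fin k → Fin 3, coloringSign K g * ∏ i, nbhdSign f (N i) (g i)) *
        coloringSign H f := by
  classical
  rw [phiSum_eq, Fintype.card_sum, Fintype.card_fin, pow_add, mul_inv, sum_sum_elim]
  congr 1
  refine Finset.sum_congr rfl fun f _ => ?_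
  rw [Finset.sum_mul]
  refine Finset.sum_congr rfl fun g _ => ?_
  rw [coloringSign_sum]
  rfl

theorem coloringSign_bot {V : Type*} [Fintype V] (c : V → Fin 3) :
    coloringSign (⊥ : SimpleGraph V) c = 1 :=
  Finset.prod_eq_one fun e _ => by simp [pairSign]

open Classical in
theorem coloringSign_fin_two (K : SimpleGraph (Fin 2)) (g : Fin 2 → Fin 3) :
    coloringSign K g = if K.Adj 0 1 then edgeSign (g 0) (g 1) else 1 := by
  have : (Finset.univ : Finset (Fin 2)) = insert 0 (insert 1 ∅) := by decide
  rw [coloringSign, this, prod_sym2_insert _ (by simp), prod_sym2_insert _ (by simp)]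
  simp

open Classical in
theorem coloringSign_fin_three (K : SimpleGraph (Fin 3)) (g : Fin 3 → Fin 3) :
    coloringSign K g = (if K.Adj 0 1 then edgeSign (g 0) (g 1) else 1) *
      (if K.Adj 0 2 then edgeSign (g 0) (g 2) else 1) *
      (if K.Adj 1 2 then edgeSign (g 1) (g 2) else 1) := by
  have : (Finset.univ : Finset (Fin 3)) = insert 0 (insert 1 (insert 2 ∅)) := by decide
  rw [coloringSign, this, prod_sym2_insert _ (by simp), prod_sym2_insert _ (by simp),
    prod_sym2_insert _ (by simp)]
  simp

theorem sum_fin_two (F : (Fin 2 → Fin 3) → ℂ) : ∑ g, F g = ∑ i, ∑ j, F ![i, j] := by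
  rw [← Fintype.sum_prod_type']
  exact Fintype.sum_equiv (finTwoArrowEquiv (Fin 3)) _ _ fun g => by
    congr 1; funext i; fin_cases i <;> rfl

theorem sum_fin_three (F : (Fin 3 → Fin 3) → ℂ) : ∑ g, F g = ∑ i, ∑ j, ∑ k, F ![i, j, k] := by
  simp only [← Fintype.sum_prod_type']
  let e : (Fin 3 → Fin 3) ≃ (Fin 3 × Fin 3) × Fin 3 :=
    { toFun := fun g => ((g 0, g 1), g 2)
      invFun := fun p => ![p.1.1, p.1.2, p.2]
      left_inv := fun g => by funext i; fin_cases i <;> rfl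
      right_inv := fun p => rfl }
  exact Fintype.sum_equiv e F (fun p => F ![p.1.1, p.1.2, p.2])
    fun g => congrArg F (e.left_inv g).symm

section Relations

variable {V : Type} [Fintype V] [DecidableEq V] (H : SimpleGraph V)

theorem phiSum_joined (a b : Set V) :
    phiSum (joined H a b) = (64 : ℂ)⁻¹ * ((8 : ℂ) ^ Fintype.card V)⁻¹ *
      ∑ f : V → Fin 3, (∑ i, ∑ j, edgeSign i j * (nbhdSign f a i * nbhdSign f b j)) *
        coloringSign H f := by
  rw [joined, phiSum_attach, show (8 : ℂ) ^ 2 = 64 by norm_num]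
  simp [sum_fin_two, coloringSign_fin_two]

theorem phiSum_separate (a b : Set V) :
    phiSum (separate H a b) = (64 : ℂ)⁻¹ * ((8 : ℂ) ^ Fintype.card V)⁻¹ *
      ∑ f : V → Fin 3, (∑ i, ∑ j, nbhdSign f a i * nbhdSign f b j) * coloringSign H f := by
  rw [separate, phiSum_attach, show (8 : ℂ) ^ 2 = 64 by norm_num]
  simp [sum_fin_two, coloringSign_bot]

open Classical in
theorem phiSum_triple (x y z : Set V) (E : Set (Sym2 (Fin 3))) :
    phiSum (triple H x y z E) = (512 : ℂ)⁻¹ * ((8 : ℂ) ^ Fintype.card V)⁻¹ *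
      ∑ f : V → Fin 3, (∑ i, ∑ j, ∑ k, (if s(0, 1) ∈ E then edgeSign i j else 1) *
        (if s(0, 2) ∈ E then edgeSign i k else 1) * (if s(1, 2) ∈ E then edgeSign j k else 1) *
          (nbhdSign f x i * nbhdSign f y j * nbhdSign f z k)) * coloringSign H f := by
  rw [triple, phiSum_attach, show (8 : ℂ) ^ 3 = 512 by norm_num]
  simp [sum_fin_three, coloringSign_fin_three, Fin.prod_univ_three]

end Relations

/-- The difference of both sides is a sum over pairs of colors for each coloring of the hidden
part; with the signs of `a` and `b` given, the sums agree. -/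
theorem phi_isFourInvariant : IsFourInvariant phi := by
  intro V _ H a b
  classical
  have := Fintype.ofFinite V
  simp only [phi_cls, phiSum_joined, phiSum_separate, ← mul_sub, ← Finset.sum_sub_distrib,
    ← sub_mul]
  congr 1
  refine Finset.sum_congr rfl fun f _ => ?_
  congr 1
  simp only [nbhdSign_symmDiff, Fin.sum_univ_three, nbhdSign_two, edgeSign_values]
  rcases nbhdSign_eq_or f a 0 with h₁ | h₁ <;> rcases nbhdSign_eq_or f a 1 with h₂ | h₂ <;>
    rcases nbhdSign_eq_or f b 0 with h₃ | h₃ <;> rcases nbhdSign_eq_or f b 1 with h₄ | h₄ <;>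
    simp only [h₁, h₂, h₃, h₄] <;> norm_num

/-- Both six-term relations reduce to an identity for each coloring of the hidden part; the
normalizations `8 ^ (-3)` and `8 ^ (-2)` turn the coefficient `1 / 2` into `4`. -/
theorem six_term_of_signs {ι : Type*} [Fintype ι] (K : ℂ) {h T₁ T₂ T₃ T₄ S₁ S₂ : ι → ℂ}
    (hT : ∀ f, T₁ f - T₂ f - T₃ f + T₄ f = 4 * (S₁ f - S₂ f)) :
    512⁻¹ * K * ∑ f, T₁ f * h f - 512⁻¹ * K * ∑ f, T₂ f * h f - 512⁻¹ * K * ∑ f, T₃ f * h f +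
        512⁻¹ * K * ∑ f, T₄ f * h f =
      1 / 2 * (64⁻¹ * K * ∑ f, S₁ f * h f) - 1 / 2 * (64⁻¹ * K * ∑ f, S₂ f * h f) := by
  have e : ∑ f, (T₁ f - T₂ f - T₃ f + T₄ f) * h f = ∑ f, 4 * (S₁ f - S₂ f) * h f := by
    simp only [hT]
  simp only [add_mul, sub_mul, mul_sub, Finset.sum_add_distrib, Finset.sum_sub_distrib,
    mul_assoc, ← Finset.mul_sum] at e
  linear_combination 512⁻¹ * K * e

set_option maxHeartbeats 1000000 in
theorem phi_six_term_first {V : Type} [Finite V] (H : SimpleGraph V) (x y z : Set V) :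
    phi (cls (triple H x y z {s(0, 1), s(1, 2)})) -
        phi (cls (triple H x y z {s(0, 1)})) -
        phi (cls (triple H x y z {s(1, 2)})) + phi (cls (triple H x y z ∅)) =
      1 / 2 * phi (cls (separate H y (x ∆ y ∆ z))) -
        1 / 2 * phi (cls (joined H (x ∆ y) (y ∆ z))) := by
  classical
  have := Fintype.ofFinite V
  simp only [phi_cls, phiSum_joined, phiSum_separate, phiSum_triple]
  refine six_term_of_signs _ fun f => ?_
  simp [Fin.sum_univ_three, nbhdSign_symmDiff, nbhdSign_two, edgeSign_values]
  -- the identity involves six signs: those of the three sets for two of the three colors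
  rcases nbhdSign_eq_or f x 0 with h₁ | h₁ <;> rcases nbhdSign_eq_or f x 1 with h₂ | h₂ <;>
    rcases nbhdSign_eq_or f y 0 with h₃ | h₃ <;> rcases nbhdSign_eq_or f y 1 with h₄ | h₄ <;>
    rcases nbhdSign_eq_or f z 0 with h₅ | h₅ <;> rcases nbhdSign_eq_or f z 1 with h₆ | h₆ <;>
    simp only [h₁, h₂, h₃, h₄, h₅, h₆] <;> norm_num

set_option maxHeartbeats 1000000 in
theorem phi_six_term_second {V : Type} [Finite V] (H : SimpleGraph V) (x y z : Set V) :
    phi (cls (triple H x y z {s(0, 2), s(0, 1), s(1, 2)})) -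
        phi (cls (triple H x y z {s(0, 2), s(0, 1)})) -
        phi (cls (triple H x y z {s(0, 2), s(1, 2)})) + phi (cls (triple H x y z {s(0, 2)})) =
      1 / 2 * phi (cls (separate H y (x ∆ y ∆ z))) -
        1 / 2 * phi (cls (separate H (x ∆ y) (y ∆ z))) := by
  classical
  have := Fintype.ofFinite V
  simp only [phi_cls, phiSum_separate, phiSum_triple]
  refine six_term_of_signs _ fun f => ?_
  simp [Fin.sum_univ_three, nbhdSign_symmDiff, nbhdSign_two, edgeSign_values]
  -- the identity involves six signs: those of the three sets for two of the three colors
  rcases nbhdSign_eq_or f x 0 with h₁ | h₁ <;> rcases nbhdSign_eq_or f x 1 with h₂ | h₂ <;>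
    rcases nbhdSign_eq_or f y 0 with h₃ | h₃ <;> rcases nbhdSign_eq_or f y 1 with h₄ | h₄ <;>
    rcases nbhdSign_eq_or f z 0 with h₅ | h₅ <;> rcases nbhdSign_eq_or f z 1 with h₆ | h₆ <;>
    simp only [h₁, h₂, h₃, h₄, h₅, h₆] <;> norm_num

theorem phi_satisfiesGraphCV : SatisfiesGraphCV phi (3 / 8) where
  normalization := by
    rw [phi_cls, phiSum_eq]
    simp [coloringSign_bot]
    norm_num
  multiplicativity V W _ _ G H := by
    classical
    have := Fintype.ofFinite V
    have := Fintype.ofFinite W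
    rw [phi_cls, phi_cls, phi_cls, phiSum_eq, phiSum_eq, phiSum_eq, Fintype.card_sum, pow_add,
      mul_inv, sum_sum_elim, mul_mul_mul_comm, Finset.sum_mul_sum, Finset.sum_comm]
    congr 1
    refine Finset.sum_congr rfl fun g _ => Finset.sum_congr rfl fun f _ => ?_
    rw [coloringSign_sum]
    have e₁ : (G ⊕g H).comap Sum.inl = G := by ext; simp
    have e₂ : (G ⊕g H).comap Sum.inr = H := by ext; simp
    rw [e₁, e₂]
    simp
  leaf_deletion V _ G v := by
    rintro ⟨u, hu, huniq⟩
    classical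
    have := Fintype.ofFinite V
    let u' : ({v}ᶜ : Set V) := ⟨u, fun h => G.ne_of_adj hu h.symm⟩
    let e : Fin 1 ⊕ ({v}ᶜ : Set V) ≃ V := Equiv.ofBijective (Sum.elim (fun _ => v) Subtype.val) (by
      constructor
      · rintro (i | x) (j | y) h
        · rw [Subsingleton.elim i j]
        · exact absurd h.symm y.2
        · exact absurd h x.2
        · exact congrArg _ (Subtype.ext h)
      · intro x
        by_cases hx : x = v
        · exact ⟨.inl 0, hx.symm⟩
        · exact ⟨.inr ⟨x, hx⟩, rfl⟩)
    have iso : attach (⊥ : SimpleGraph (Fin 1)) (fun _ => {u'}) (G.induce {v}ᶜ) ≃g G := by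
      refine ⟨e, ?_⟩
      rintro (i | x) (j | y)
      · change G.Adj v v ↔ False
        simp
      · change G.Adj v y ↔ y = u'
        exact ⟨fun h => Subtype.ext (huniq _ h), fun h => h ▸ hu⟩
      · change G.Adj x v ↔ x = u'
        exact ⟨fun h => Subtype.ext (huniq _ h.symm), fun h => h ▸ hu.symm⟩
      · rfl
    rw [phi_cls, phi_cls, ← phiSum_congr iso, phiSum_attach, phiSum_eq (G.induce {v}ᶜ)]
    -- among the three colors of the leaf, one gives the sign `1` and two give `-1`
    have hs : ∀ f : ({v}ᶜ : Set V) → Fin 3, (∑ g : Fin 1 → Fin 3,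
        coloringSign (⊥ : SimpleGraph (Fin 1)) g * ∏ i, nbhdSign f {u'} (g i)) = -1 := by
      intro f
      simp only [coloringSign_bot, one_mul, Fin.prod_univ_one]
      rw [Fintype.sum_equiv (Equiv.funUnique (Fin 1) (Fin 3))
        (fun g : Fin 1 → Fin 3 => nbhdSign f {u'} (g 0)) (fun k => nbhdSign f {u'} k)
        fun g => rfl]
      have : ∀ k, nbhdSign f {u'} k = edgeSign k (f u') := fun k => by
        rw [nbhdSign, Finset.prod_eq_single u'] <;> simp +contextual
      simp only [this, Fin.sum_univ_three]
      generalize f u' = k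
      fin_cases k <;> simp [edgeSign_values]
    simp only [hs]
    rw [Finset.mul_sum, Finset.mul_sum, Finset.mul_sum]
    refine Finset.sum_congr rfl fun f _ => ?_
    ring
  six_term_first V _ H x y z := phi_six_term_first H x y z
  six_term_second V _ H x y z := phi_six_term_second H x y z

/-! ### The two-dimensional representation and intersection graphs -/

/-- In dimension two the spin matrices are multiples of the Pauli matrices. -/
theorem spinMatrix_two (s : ℂ) : spinMatrix 2 s =
    ![(-(Complex.I * s / 2)) • !![0, 1; 1, 0], (-(s / 2)) • !![0, 1; -1, 0],
      (-(Complex.I * s / 2)) • !![1, 0; 0, -1]] := by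
  have hE : raiseMatrix 2 = !![0, 1; 0, 0] := by
    ext i j; fin_cases i <;> fin_cases j <;> simp [raiseMatrix]; norm_num
  have hF : lowerMatrix 2 = !![0, 0; 1, 0] := by
    ext i j; fin_cases i <;> fin_cases j <;> simp [lowerMatrix]
  have hH : weightMatrix 2 = !![1, 0; 0, -1] := by
    ext i j; fin_cases i <;> fin_cases j <;> simp [weightMatrix]; norm_num
  have hp : raiseMatrix 2 + lowerMatrix 2 = !![0, 1; 1, 0] := by
    rw [hE, hF]; ext i j; fin_cases i <;> fin_cases j <;> simp
  have hm : raiseMatrix 2 - lowerMatrix 2 = !![0, 1; -1, 0] := by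
    rw [hE, hF]; ext i j; fin_cases i <;> fin_cases j <;> simp
  rw [spinMatrix, hp, hm, hH]

theorem spinMatrix_two_mul (s : ℂ) (j k : Fin 3) :
    spinMatrix 2 s j * spinMatrix 2 s k =
      edgeSign j k • (spinMatrix 2 s k * spinMatrix 2 s j) := by
  rw [spinMatrix_two]
  ext a b
  fin_cases j <;> fin_cases k <;> fin_cases a <;> fin_cases b <;>
    simp [edgeSign_values, Matrix.mul_apply] <;> ring

theorem spinMatrix_two_sq {s : ℂ} (hs : s * s = -(1 / 2)) (k : Fin 3) :
    spinMatrix 2 s k * spinMatrix 2 s k = (1 / 8 : ℂ) • 1 := by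
  have hI : Complex.I * s / 2 * (Complex.I * s / 2) = 8⁻¹ := by
    linear_combination (s * s / 4) * Complex.I_mul_I - 1 / 4 * hs
  have hs' : s / 2 * (s / 2) = -8⁻¹ := by linear_combination 1 / 4 * hs
  rw [spinMatrix_two]
  ext a b
  fin_cases k <;> fin_cases a <;> fin_cases b <;>
    simp [Matrix.mul_apply, hI, hs']

section Anticommuting

variable {A : Type*} [Ring A] [Algebra ℂ A] {X : Fin 3 → A}

theorem mul_wordProd_eq_smul (hX : ∀ j k, X j * X k = edgeSign j k • (X k * X j)) (i : Fin 3)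
    (U : List ℕ) (f : ℕ → Fin 3) :
    X i * wordProd X U f = (U.map fun u => edgeSign i (f u)).prod • (wordProd X U f * X i) := by
  induction U with
  | nil => simp
  | cons u U ih =>
    rw [wordProd_cons, ← mul_assoc, hX, smul_mul_assoc, mul_assoc, ih, List.map_cons,
      List.prod_cons, mul_smul_comm, smul_smul, mul_assoc]

/-- The graph on all names whose edges are the interlaced pairs of a word. -/
def wordGraph (l : List ℕ) : SimpleGraph ℕ where
  Adj := Interlaced l
  symm := ⟨fun _ _ h => ⟨h.1.symm, h.2.symm⟩⟩
  loopless := ⟨fun _ h => h.1 rfl⟩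

/-- Removing the chord `a` does not change which of the other chords intersect. -/
theorem interlaced_remove_iff {a x y : ℕ} {U V : List ℕ} (haU : a ∉ U) (haV : a ∉ V)
    (hx : x ≠ a) (hy : y ≠ a) :
    Interlaced (a :: (U ++ a :: V)) x y ↔ Interlaced (U ++ V) x y := by
  have hf := filter_ne_cons_append_cons haU haV
  have key : ∀ u v, u ≠ a → v ≠ a →
      ([u, v, u, v].Sublist (a :: (U ++ a :: V)) ↔ [u, v, u, v].Sublist (U ++ V)) := by
    intro u v hu hv
    refine ⟨fun h => ?_, fun h => h.trans (hf ▸ List.filter_sublist)⟩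
    have := h.filter (fun z => decide (z ≠ a))
    rw [hf] at this
    simpa [hu, hv] using this
  rw [Interlaced, Interlaced, key x y hx hy, key y x hy hx]

/-- Anticommuting square roots of `1/8`: the product along a chord word is a scalar, with one
sign for each pair of intersecting chords of different colors. -/
theorem wordProd_eq_smul (hX : ∀ j k, X j * X k = edgeSign j k • (X k * X j))
    (hX2 : ∀ k, X k * X k = (1 / 8 : ℂ) • 1) (f : ℕ → Fin 3) (l : List ℕ)
    (hl : ∀ x ∈ l, l.count x = 2) :
    wordProd X l f = (((8 : ℂ) ^ l.toFinset.card)⁻¹ *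
      ∏ e ∈ l.toFinset.sym2, pairSign (wordGraph l) f e) • (1 : A) := by
  classical
  induction hn : l.length using Nat.strong_induction_on generalizing l with | _ n ih =>
  rcases l with _ | ⟨a, m⟩
  · simp
  have ha := hl a (by simp)
  rw [List.count_cons_self] at ha
  obtain ⟨U, V, rfl, haU, haV⟩ := exists_eq_of_count_eq_one (by omega : m.count a = 1)
  have hUV : ∀ x ∈ U ++ V, (U ++ V).count x = 2 := by
    intro x hx
    have hxa : a ≠ x := by rintro rfl; simp [haU, haV] at hx
    have := hl x (by simp at hx ⊢; tauto)
    simpa [hxa] using this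
  have haW : a ∉ (U ++ V).toFinset := by simp [haU, haV]
  have hins : (a :: (U ++ a :: V)).toFinset = insert a (U ++ V).toFinset := by
    ext x; simp
  have hrest : ∏ e ∈ (U ++ V).toFinset.sym2, pairSign (wordGraph (a :: (U ++ a :: V))) f e =
      ∏ e ∈ (U ++ V).toFinset.sym2, pairSign (wordGraph (U ++ V)) f e := by
    refine Finset.prod_congr rfl fun e he => ?_
    induction e with | _ x y =>
    rw [Finset.mk_mem_sym2_iff] at he
    have hx : x ≠ a := fun e => haW (e ▸ he.1)
    have hy : y ≠ a := fun e => haW (e ▸ he.2)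
    simp only [pairSign_mk]
    exact if_congr (interlaced_remove_iff haU haV hx hy) rfl rfl
  have hsign : (U.map fun u => edgeSign (f a) (f u)).prod =
      ∏ b ∈ (U ++ V).toFinset, pairSign (wordGraph (a :: (U ++ a :: V))) f s(a, b) := by
    rw [Finset.prod_list_map_count,
      Finset.prod_subset (s₂ := (U ++ V).toFinset)
      (fun x hx => by simp at hx ⊢; exact Or.inl hx)
      fun x _ hx => by
        rw [List.count_eq_zero_of_not_mem (by simpa using hx), pow_zero]]
    refine Finset.prod_congr rfl fun b hb => ?_
    have hb' : b ∈ U ++ V := by simpa using hb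
    have hba : b ≠ a := fun e => haW (e ▸ hb)
    have h2 := hUV b hb'
    rw [List.count_append] at h2
    rw [pairSign_mk]
    refine Eq.trans ?_ (if_congr (interlaced_cons_iff haU haV hba) rfl rfl).symm
    by_cases hbU : b ∈ U
    · have h3 := List.count_pos_iff.2 hbU
      by_cases hbV : b ∈ V
      · have h4 := List.count_pos_iff.2 hbV
        simp [hbU, hbV, (by omega : U.count b = 1)]
      · rw [List.count_eq_zero_of_not_mem hbV] at h2
        rw [show U.count b = 2 by omega, sq, edgeSign_mul_self]
        simp [hbV]
    · simp [hbU, List.count_eq_zero_of_not_mem hbU]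
  have haa : pairSign (wordGraph (a :: (U ++ a :: V))) f s(a, a) = 1 := by simp
  rw [hins, prod_sym2_insert _ haW, Finset.card_insert_of_notMem haW, hrest, haa, ← hsign,
    wordProd_cons, wordProd_append, wordProd_cons, ← mul_assoc, mul_wordProd_eq_smul hX, smul_mul_assoc,
    mul_assoc, ← mul_assoc (X (f a)), hX2, smul_one_mul, mul_smul_comm, ← wordProd_append,
    ih (U ++ V).length (by simp at hn ⊢; omega) (U ++ V) hUV rfl, smul_smul, smul_smul, pow_succ]
  congr 1
  rw [mul_inv]
  ring

end Anticommuting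

theorem coloringSign_interGraph (D : ChordWord) (f : ℕ → Fin 3)
    [Fintype {a // a ∈ D.letters}] :
    coloringSign D.interGraph (f ∘ Subtype.val) =
      ∏ e ∈ D.letters.toFinset.sym2, pairSign (wordGraph D.letters) f e := by
  have : D.letters.toFinset = (Finset.univ : Finset {a // a ∈ D.letters}).image Subtype.val := by
    ext x; simp
  rw [this, Finset.sym2_image, Finset.prod_image
    (Sym2.map.injective Subtype.val_injective).injOn, coloringSign]
  refine Finset.prod_congr rfl fun e _ => ?_
  induction e with | _ x y => simp [ChordWord.interGraph, wordGraph]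

/-- On intersection graphs, `phi` is the weight system of the two-dimensional representation. -/
theorem phi_intersectionGraph {s : ℂ} (hs : s * s = -(1 / 2)) (D : ChordDiagram) :
    phi (intersectionGraph D) =
      traceWeight (spinMatrix 2 s) (normalizedTrace 2) (normalizedTrace_mul_comm 2) D := by
  induction D using Quotient.inductionOn with | _ D =>
  change phi (intersectionGraph D.diagram) = traceWeight _ _ _ D.diagram
  classical
  have := Fintype.ofFinite {a // a ∈ D.letters}
  rw [intersectionGraph_diagram, phi_cls, phiSum_eq, traceWeight_diagram]
  set L : List ℕ := (Finset.univ : Finset {a // a ∈ D.letters}).toList.map Subtype.val with hL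
  rw [stateSum_eq _ (L := L) ((Finset.nodup_toList _).map Subtype.val_injective) (by simp [hL]) 0,
    show wordProd (spinMatrix 2 s) D.letters = fun f => (((8 : ℂ) ^ D.letters.toFinset.card)⁻¹ *
      ∏ e ∈ D.letters.toFinset.sym2, pairSign (wordGraph D.letters) f e) • 1 from
      funext fun f => wordProd_eq_smul (spinMatrix_two_mul s) (spinMatrix_two_sq hs) f _ D.twice]
  have ht := colorSum_map (normalizedTrace 2).toAddMonoidHom L
    (fun f => (((8 : ℂ) ^ D.letters.toFinset.card)⁻¹ *
      ∏ e ∈ D.letters.toFinset.sym2, pairSign (wordGraph D.letters) f e) •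
        (1 : Matrix (Fin 2) (Fin 2) ℂ)) 0
  simp only [LinearMap.toAddMonoidHom_coe] at ht
  rw [← ht]
  simp only [map_smul, normalizedTrace_one 2 two_ne_zero, smul_eq_mul, mul_one,
    ← coloringSign_interGraph]
  rw [colorSum_relabel Subtype.val_injective _
    (fun c => ((8 : ℂ) ^ D.letters.toFinset.card)⁻¹ * coloringSign D.interGraph c),
    colorSum_eq_sum (Finset.nodup_toList _) (by simp), ← Finset.mul_sum]
  rw [Fintype.card_of_subtype D.letters.toFinset (by simp)]

end SlTwo

theorem theorem3p6 :
    SlTwo.IsFourInvariant SlTwo.phi ∧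
    SlTwo.SatisfiesGraphCV SlTwo.phi (3 / 8) ∧
    (∃! w : SlTwo.ChordDiagram → Polynomial ℂ, SlTwo.IsSl2WeightSystem w) ∧
    (∀ w : SlTwo.ChordDiagram → Polynomial ℂ, SlTwo.IsSl2WeightSystem w →
      ∀ D : SlTwo.ChordDiagram,
        SlTwo.phi (SlTwo.intersectionGraph D) = (w D).eval (3 / 8)) := by
  refine ⟨SlTwo.phi_isFourInvariant, SlTwo.phi_satisfiesGraphCV,
    SlTwo.existsUnique_isSl2WeightSystem, fun w hw D => ?_⟩
  obtain ⟨s, hs⟩ := SlTwo.exists_mul_self_eq_neg_half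
  have h := SlTwo.isWeightSystemAt_irreducible two_ne_zero hs
  rw [show (((2 : ℕ) : ℂ) ^ 2 - 1) / 8 = 3 / 8 by norm_num] at h
  rw [SlTwo.phi_intersectionGraph hs, h.eq_eval (by norm_num), hw.eq_universalWeight]
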